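/- Let $n$ be a natural number and let $X, Y$ be independent random vectors in $\mathbb{R}^n$, each having a continuous, everywhere positive density with respect to Lebesgue measure, finite second moments, and finite differential entropy, where the differential entropy of a random vector $X$ with density $f$ is $h(X) = -\int_{\mathbb{R}^n} f(x)\log f(x)\,dx$ (it is called finite when this integral converges absolutely). Then for every real $\lambda$ with $0<\lambda<1$, the random vector $\sqrt{\lambda}\,X + \sqrt{1-\lambda}\,Y$ has a density and finite differential entropy, and $$h\bigl(\sqrt{\lambda}\,X + \sqrt{1-\lambda}\,Y\bigr) \ge \lambda\, h(X) + (1-\lambda)\, h(Y).$$ Moreover, for each such $\lambda$, equality holds if and only if $X$ and $Y$ are both Gaussian (with non-singular covariance matrices) and have identical covariance matrices (their means may differ). -/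

import Mathlib

open MeasureTheory ProbabilityTheory

/-- The random vector `X` in `ℝⁿ` has a density with respect to Lebesgue measure which has a
version that is continuous and (everywhere) positive. -/
structure HasContinuousPositiveDensity {Ω : Type*} [MeasurableSpace Ω] {n : ℕ}
    (X : Ω → EuclideanSpace ℝ (Fin n)) (P : Measure Ω) : Prop where
  aemeasurable : AEMeasurable X P
  exists_density : ∃ f : EuclideanSpace ℝ (Fin n) → ℝ, Continuous f ∧ (∀ x, 0 < f x) ∧
    P.map X = (volume : Measure (EuclideanSpace ℝ (Fin n))).withDensity
      (fun x => ENNReal.ofReal (f x))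

/-- The differential entropy `h(X) = - ∫ f log f` (natural logarithm, `0 log 0 = 0`), where `f` is
the density of the random vector `X` with respect to Lebesgue measure on `ℝⁿ`.
It is meaningful when `HasFiniteDifferentialEntropy X P` holds. -/
noncomputable def differentialEntropy {Ω : Type*} [MeasurableSpace Ω] {n : ℕ}
    (X : Ω → EuclideanSpace ℝ (Fin n)) (P : Measure Ω) : ℝ :=
  - ∫ x, (pdf X P volume x).toReal * Real.log (pdf X P volume x).toReal

/-- `X` has a density `f` with respect to Lebesgue measure on `ℝⁿ`, and the integral
`- ∫ f log f` that defines its differential entropy converges absolutely (equivalently, is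
well-defined and finite). -/
structure HasFiniteDifferentialEntropy {Ω : Type*} [MeasurableSpace Ω] {n : ℕ}
    (X : Ω → EuclideanSpace ℝ (Fin n)) (P : Measure Ω) : Prop where
  hasPDF : HasPDF X P volume
  integrable : Integrable
    (fun x => (pdf X P volume x).toReal * Real.log (pdf X P volume x).toReal) volume

/-- The covariance matrix `(Cov(X_i, X_j))_{i,j}` of a random vector `X` in `ℝⁿ`. -/
noncomputable def covarianceMatrix {Ω : Type*} [MeasurableSpace Ω] {n : ℕ}
    (X : Ω → EuclideanSpace ℝ (Fin n)) (P : Measure Ω) : Matrix (Fin n) (Fin n) ℝ :=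
  Matrix.of fun i j => covariance (fun ω => X ω i) (fun ω => X ω j) P

/-- `X` is a Gaussian random vector, non-degenerate in the sense that its (positive semidefinite)
covariance matrix is non-singular. -/
structure IsGaussianVector {Ω : Type*} [MeasurableSpace Ω] {n : ℕ}
    (X : Ω → EuclideanSpace ℝ (Fin n)) (P : Measure Ω) : Prop where
  hasGaussianLaw : HasGaussianLaw X P
  isUnit_det : IsUnit (covarianceMatrix X P).det

/-!
The proof transports `X` and `Y` to Gaussian variables, one coordinate at a time, by increasing maps
of each coordinate conditionally on the preceding ones.

For a positive density `f` on the line let `S_f` be the *normal score*, the increasing map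
`Φ⁻¹ ∘ F_f` that sends the law with density `f` to the standard Gaussian law with density `φ`; at
almost every point `S_f' = f / φ(S_f)`. For densities `f`, `g` fix the value `z` of
`√lam u + √(1 - lam) v`. Along this line the quantity `√lam S_g(v) - √(1 - lam) S_f(u)` is an
increasing function of `v`, and the change of variable bounds the integral of its Gaussian density
against `(1 - lam) S_f'(u) + lam S_g'(v)`. By the arithmetic-geometric mean inequality this sum is a
factor `ρ ≥ 1` times `S_f'(u)^(1 - lam) S_g'(v)^lam`, and all Gaussian densities collapse into
`exp (√lam √(1 - lam) S_f(u) S_g(v))`. The outcome (`IsPositiveDensity.lintegral_kernel_le`) is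
`∫∫ F(√lam u + √(1 - lam) v) exp(M(u, v)) ρ(u, v) f(u)^(1 - lam) g(v)^lam ≤ ∫ F` for all measurable
`F ≥ 0`, where `M = √lam √(1 - lam) S_f S_g` has mean zero under `f ⊗ g` because it is a product of
independent centred variables.

Such a pair `(M, ρ)` is called a transport kernel (`HasTransportKernel`). Kernels are multiplied
along conditional densities (`HasTransportKernel.prod`), which gives them in every dimension. With
`F` the density of `Z = √lam X + √(1 - lam) Y`, the inequality says that the exponential of
`log F(Z) + M + log ρ - lam log f(X) - (1 - lam) log g(Y)` has expectation at most one, so the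
exponent has nonpositive expectation (`HasTransportKernel.integral_log_le`). This is the entropy
inequality. Its integrability requirements come from the second moments, by comparing the density
of `Z` with `exp (-‖z‖ ^ 2)` (`exists_integrable_le_log_density`).

If equality holds, then `log ρ` has expectation zero, so `ρ = 1` almost everywhere. Here `ρ` is kept
from the first coordinate only; there it forces `S_f'(u) = S_g'(v)` for almost all `u` and `v`, so
both are constant, and the first coordinates of `X` and `Y` are Gaussian with the same variance
(`IsPositiveDensity.gaussian_of_amGmRatio_eq_one`). An orthonormal basis can be chosen with any unit
vector in first position, so the same holds for every linear form, which is the definition of a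
Gaussian vector and identifies the covariances. Conversely, Gaussian vectors with equal covariance
matrices and their normalized sum have the same law up to translation, hence the same entropy.
-/

open Set Filter Topology
open scoped ENNReal NNReal

/-! ### Positive densities -/

/-- The measure with density `f` with respect to the volume. -/
noncomputable def densityMeasure {E : Type*} [MeasureSpace E] (f : E → ℝ) : Measure E :=
  volume.withDensity fun x => ENNReal.ofReal (f x)

/-- `f` is a measurable and everywhere positive probability density. -/
structure IsPositiveDensity {E : Type*} [MeasureSpace E] (f : E → ℝ) : Prop where
  measurable : Measurable f
  pos : ∀ x, 0 < f x
  lintegral_eq_one : ∫⁻ x, ENNReal.ofReal (f x) = 1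

section PositiveDensity

variable {E : Type*} [MeasureSpace E] {f : E → ℝ}

theorem IsPositiveDensity.isProbabilityMeasure (hf : IsPositiveDensity f) :
    IsProbabilityMeasure (densityMeasure f) :=
  ⟨by rw [densityMeasure, withDensity_apply _ MeasurableSet.univ, setLIntegral_univ,
    hf.lintegral_eq_one]⟩

theorem densityMeasure_absolutelyContinuous : densityMeasure f ≪ volume :=
  withDensity_absolutelyContinuous _ _

theorem IsPositiveDensity.volume_absolutelyContinuous (hf : IsPositiveDensity f) :
    volume ≪ densityMeasure f :=
  withDensity_absolutelyContinuous' hf.measurable.ennreal_ofReal.aemeasurable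
    (ae_of_all _ fun x => (ENNReal.ofReal_pos.2 (hf.pos x)).ne')

theorem IsPositiveDensity.lintegral_densityMeasure (hf : IsPositiveDensity f) (g : E → ℝ≥0∞) :
    ∫⁻ x, g x ∂(densityMeasure f) = ∫⁻ x, ENNReal.ofReal (f x) * g x := by
  rw [densityMeasure, lintegral_withDensity_eq_lintegral_mul_non_measurable _
    hf.measurable.ennreal_ofReal (ae_of_all _ fun _ => ENNReal.ofReal_lt_top)]
  rfl

theorem IsPositiveDensity.integrable (hf : IsPositiveDensity f) : Integrable f := by
  refine ⟨hf.measurable.aestronglyMeasurable, ?_⟩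
  rw [hasFiniteIntegral_iff_ofReal (ae_of_all _ fun x => (hf.pos x).le), hf.lintegral_eq_one]
  exact ENNReal.one_lt_top

end PositiveDensity

/-! ### The normal score of a density on the line -/

section Score

variable {f : ℝ → ℝ}

/-- The density of the standard Gaussian distribution on the line. -/
noncomputable def stdGaussianDensity : ℝ → ℝ := gaussianPDFReal 0 1

theorem isPositiveDensity_stdGaussianDensity : IsPositiveDensity stdGaussianDensity :=
  ⟨measurable_gaussianPDFReal 0 1, fun x => gaussianPDFReal_pos 0 1 x one_ne_zero,
    lintegral_gaussianPDFReal_eq_one 0 one_ne_zero⟩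

theorem densityMeasure_stdGaussianDensity :
    densityMeasure stdGaussianDensity = gaussianReal 0 1 := by
  rw [gaussianReal_of_var_ne_zero _ one_ne_zero]
  rfl

theorem continuous_stdGaussianDensity : Continuous stdGaussianDensity := by
  unfold stdGaussianDensity gaussianPDFReal
  fun_prop

theorem IsPositiveDensity.cdf_eq_setIntegral (hf : IsPositiveDensity f) (x : ℝ) :
    cdf (densityMeasure f) x = ∫ t in Iic x, f t := by
  have := hf.isProbabilityMeasure
  rw [cdf_eq_real, measureReal_def, densityMeasure, withDensity_apply _ measurableSet_Iic,
    integral_eq_lintegral_of_nonneg_ae (ae_of_all _ fun t => (hf.pos t).le)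
      hf.measurable.aestronglyMeasurable]

theorem IsPositiveDensity.cdf_eq_add_intervalIntegral (hf : IsPositiveDensity f) (x : ℝ) :
    cdf (densityMeasure f) x = cdf (densityMeasure f) 0 + ∫ t in (0 : ℝ)..x, f t := by
  rw [hf.cdf_eq_setIntegral, hf.cdf_eq_setIntegral,
    ← intervalIntegral.integral_Iic_sub_Iic hf.integrable.integrableOn hf.integrable.integrableOn]
  ring

theorem IsPositiveDensity.continuous_cdf (hf : IsPositiveDensity f) :
    Continuous (cdf (densityMeasure f)) := by
  rw [funext hf.cdf_eq_add_intervalIntegral]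
  exact continuous_const.add
    (intervalIntegral.continuous_primitive (fun _ _ => hf.integrable.intervalIntegrable) 0)

theorem IsPositiveDensity.strictMono_cdf (hf : IsPositiveDensity f) :
    StrictMono (cdf (densityMeasure f)) := by
  have := hf.isProbabilityMeasure
  intro a b hab
  have h : 0 < densityMeasure f (Ioc a b) := by
    refine pos_iff_ne_zero.2 fun h0 => ?_
    have := hf.volume_absolutelyContinuous h0
    simp [hab.not_ge] at this
  rw [← measure_cdf (densityMeasure f), StieltjesFunction.measure_Ioc, ENNReal.ofReal_pos] at h
  linarith

theorem IsPositiveDensity.cdf_mem_Ioo (hf : IsPositiveDensity f) (x : ℝ) :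
    cdf (densityMeasure f) x ∈ Ioo (0 : ℝ) 1 :=
  ⟨(cdf_nonneg _ (x - 1)).trans_lt (hf.strictMono_cdf (by linarith)),
    (hf.strictMono_cdf (show x < x + 1 by linarith)).trans_le (cdf_le_one _ _)⟩

theorem IsPositiveDensity.range_cdf (hf : IsPositiveDensity f) :
    range (cdf (densityMeasure f)) = Ioo (0 : ℝ) 1 := by
  refine Subset.antisymm (range_subset_iff.2 hf.cdf_mem_Ioo) fun p hp => ?_
  obtain ⟨a, ha⟩ := ((tendsto_cdf_atBot (densityMeasure f)).eventually_lt_const hp.1).exists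
  obtain ⟨b, hb⟩ := ((tendsto_cdf_atTop (densityMeasure f)).eventually_const_lt hp.2).exists
  exact mem_range_of_exists_le_of_exists_ge hf.continuous_cdf ⟨a, ha.le⟩ ⟨b, hb.le⟩

theorem IsPositiveDensity.ae_hasDerivAt_cdf (hf : IsPositiveDensity f) :
    ∀ᵐ x, HasDerivAt (cdf (densityMeasure f)) (f x) x := by
  filter_upwards [_root_.LocallyIntegrable.ae_hasDerivAt_integral
    hf.integrable.locallyIntegrable] with x hx
  rw [funext hf.cdf_eq_add_intervalIntegral]
  exact (hx 0).const_add _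

/-- The distribution function of the standard Gaussian distribution. -/
noncomputable def stdGaussianCDF : ℝ → ℝ := cdf (densityMeasure stdGaussianDensity)

theorem strictMono_stdGaussianCDF : StrictMono stdGaussianCDF :=
  isPositiveDensity_stdGaussianDensity.strictMono_cdf

theorem range_stdGaussianCDF : range stdGaussianCDF = Ioo (0 : ℝ) 1 :=
  isPositiveDensity_stdGaussianDensity.range_cdf

theorem hasDerivAt_stdGaussianCDF (x : ℝ) :
    HasDerivAt stdGaussianCDF (stdGaussianDensity x) x := by
  rw [stdGaussianCDF, funext isPositiveDensity_stdGaussianDensity.cdf_eq_add_intervalIntegral]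
  exact (continuous_stdGaussianDensity.integral_hasStrictDerivAt 0 x).hasDerivAt.const_add _

/-- The quantile function of the standard Gaussian distribution (meaningful on `(0, 1)`). -/
noncomputable def stdGaussianQuantile : ℝ → ℝ := Function.invFun stdGaussianCDF

theorem stdGaussianCDF_quantile {p : ℝ} (hp : p ∈ Ioo (0 : ℝ) 1) :
    stdGaussianCDF (stdGaussianQuantile p) = p := by
  rw [← range_stdGaussianCDF] at hp
  exact Function.invFun_eq hp

theorem stdGaussianQuantile_cdf (x : ℝ) : stdGaussianQuantile (stdGaussianCDF x) = x :=
  Function.leftInverse_invFun strictMono_stdGaussianCDF.injective x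

theorem stdGaussianCDF_mem_Ioo (x : ℝ) : stdGaussianCDF x ∈ Ioo (0 : ℝ) 1 := by
  rw [← range_stdGaussianCDF]
  exact mem_range_self x

theorem continuousAt_stdGaussianQuantile {p : ℝ} (hp : p ∈ Ioo (0 : ℝ) 1) :
    ContinuousAt stdGaussianQuantile p := by
  refine continuousAt_of_monotoneOn_of_image_mem_nhds (s := Ioo 0 1) ?_
    (isOpen_Ioo.mem_nhds hp) ?_
  · intro a ha b hb hab
    rwa [← strictMono_stdGaussianCDF.le_iff_le, stdGaussianCDF_quantile ha,
      stdGaussianCDF_quantile hb]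
  · convert! univ_mem
    exact eq_univ_of_forall fun x => ⟨_, stdGaussianCDF_mem_Ioo x, stdGaussianQuantile_cdf x⟩

theorem hasDerivAt_stdGaussianQuantile {p : ℝ} (hp : p ∈ Ioo (0 : ℝ) 1) :
    HasDerivAt stdGaussianQuantile (stdGaussianDensity (stdGaussianQuantile p))⁻¹ p :=
  HasDerivAt.of_local_left_inverse (continuousAt_stdGaussianQuantile hp)
    (hasDerivAt_stdGaussianCDF _) (isPositiveDensity_stdGaussianDensity.pos _).ne'
    (by filter_upwards [isOpen_Ioo.mem_nhds hp] with q hq using stdGaussianCDF_quantile hq)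

/-- The normal score: the increasing map that transports the distribution with density `f` to the
standard Gaussian distribution. -/
noncomputable def normalScore (f : ℝ → ℝ) (x : ℝ) : ℝ :=
  stdGaussianQuantile (cdf (densityMeasure f) x)

theorem IsPositiveDensity.stdGaussianCDF_normalScore (hf : IsPositiveDensity f) (x : ℝ) :
    stdGaussianCDF (normalScore f x) = cdf (densityMeasure f) x :=
  stdGaussianCDF_quantile (hf.cdf_mem_Ioo x)

theorem IsPositiveDensity.normalScore_le_iff (hf : IsPositiveDensity f) (x a : ℝ) :
    normalScore f x ≤ a ↔ cdf (densityMeasure f) x ≤ stdGaussianCDF a := by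
  rw [← strictMono_stdGaussianCDF.le_iff_le, hf.stdGaussianCDF_normalScore]

theorem IsPositiveDensity.strictMono_normalScore (hf : IsPositiveDensity f) :
    StrictMono (normalScore f) := by
  intro a b hab
  rw [← strictMono_stdGaussianCDF.lt_iff_lt, hf.stdGaussianCDF_normalScore,
    hf.stdGaussianCDF_normalScore]
  exact hf.strictMono_cdf hab

theorem IsPositiveDensity.continuous_normalScore (hf : IsPositiveDensity f) :
    Continuous (normalScore f) :=
  continuous_iff_continuousAt.2 fun x =>
    (continuousAt_stdGaussianQuantile (hf.cdf_mem_Ioo x)).comp hf.continuous_cdf.continuousAt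

theorem IsPositiveDensity.hasDerivAt_normalScore (hf : IsPositiveDensity f) {x d : ℝ}
    (hx : HasDerivAt (cdf (densityMeasure f)) d x) :
    HasDerivAt (normalScore f) (d / stdGaussianDensity (normalScore f x)) x := by
  have := (hasDerivAt_stdGaussianQuantile (hf.cdf_mem_Ioo x)).comp x hx
  rwa [mul_comm] at this

theorem IsPositiveDensity.surjective_normalScore (hf : IsPositiveDensity f) :
    Function.Surjective (normalScore f) := by
  intro a
  have : stdGaussianCDF a ∈ range (cdf (densityMeasure f)) := by
    rw [hf.range_cdf]
    exact stdGaussianCDF_mem_Ioo a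
  obtain ⟨x, hx⟩ := this
  exact ⟨x, by rw [normalScore, hx, stdGaussianQuantile_cdf]⟩

theorem IsPositiveDensity.map_normalScore (hf : IsPositiveDensity f) :
    (densityMeasure f).map (normalScore f) = gaussianReal 0 1 := by
  have := hf.isProbabilityMeasure
  have hm : Measurable (normalScore f) := hf.continuous_normalScore.measurable
  have := Measure.isProbabilityMeasure_map (μ := densityMeasure f) hm.aemeasurable
  refine Measure.ext_of_Iic _ _ fun a => ?_
  obtain ⟨x, rfl⟩ := hf.surjective_normalScore a
  have hpre : normalScore f ⁻¹' Iic (normalScore f x) = Iic x := by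
    ext y
    simp [hf.strictMono_normalScore.le_iff_le]
  rw [Measure.map_apply hm measurableSet_Iic, hpre, ← ofReal_cdf, ← ofReal_cdf,
    ← hf.stdGaussianCDF_normalScore, stdGaussianCDF, densityMeasure_stdGaussianDensity]

/-- A density proportional to `stdGaussianDensity ∘ normalScore f` has an affine normal score, hence
is Gaussian. The almost everywhere identity makes the distribution function continuously
differentiable, so that no absolute continuity of the score is needed. -/
theorem IsPositiveDensity.eq_gaussianReal_of_ae_eq (hf : IsPositiveDensity f) {k : ℝ} (hk : 0 < k)
    (h : ∀ᵐ x, f x = k * stdGaussianDensity (normalScore f x)) :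
    ∃ m, densityMeasure f = gaussianReal m (k⁻¹ ^ 2).toNNReal := by
  have hcont : Continuous fun x => k * stdGaussianDensity (normalScore f x) :=
    continuous_const.mul (continuous_stdGaussianDensity.comp hf.continuous_normalScore)
  have hcdf (x : ℝ) : cdf (densityMeasure f) x = cdf (densityMeasure f) 0 +
      ∫ t in (0 : ℝ)..x, k * stdGaussianDensity (normalScore f t) := by
    rw [hf.cdf_eq_add_intervalIntegral, intervalIntegral.integral_congr_ae]
    filter_upwards [h] with t ht _ using ht
  have hderiv (x : ℝ) : HasDerivAt (normalScore f) k x := by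
    have h1 : HasDerivAt (cdf (densityMeasure f))
        (k * stdGaussianDensity (normalScore f x)) x := by
      rw [funext hcdf]
      exact (hcont.integral_hasStrictDerivAt 0 x).hasDerivAt.const_add _
    have h2 := hf.hasDerivAt_normalScore h1
    rwa [mul_div_cancel_right₀ _ (isPositiveDensity_stdGaussianDensity.pos _).ne'] at h2
  have hconst : ∀ x, normalScore f x = k * x + normalScore f 0 := by
    have h1 (x : ℝ) : HasDerivAt (fun y => normalScore f y - k * y) 0 x := by
      simpa using (hderiv x).fun_sub ((hasDerivAt_id x).const_mul k)
    intro x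
    have := is_const_of_deriv_eq_zero (fun y => (h1 y).differentiableAt) (fun y => (h1 y).deriv) x 0
    simp only [mul_zero, sub_zero] at this
    linarith
  refine ⟨k⁻¹ * (0 - normalScore f 0), ?_⟩
  have hm : Measurable (normalScore f) := hf.continuous_normalScore.measurable
  have hid : (fun s => k⁻¹ * (s - normalScore f 0)) ∘ normalScore f = id := by
    ext x
    simp [hconst x, hk.ne']
  calc densityMeasure f
      = ((densityMeasure f).map (normalScore f)).map (fun s => k⁻¹ * (s - normalScore f 0)) := by
        rw [Measure.map_map (by fun_prop) hm, hid, Measure.map_id]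
    _ = ((gaussianReal 0 1).map (fun s => s - normalScore f 0)).map (fun s => k⁻¹ * s) := by
        rw [hf.map_normalScore, Measure.map_map (by fun_prop) (by fun_prop)]
        rfl
    _ = gaussianReal (k⁻¹ * (0 - normalScore f 0)) (k⁻¹ ^ 2).toNNReal := by
        rw [gaussianReal_map_sub_const, gaussianReal_map_const_mul]
        congr 1
        ext
        simp [sq_nonneg]

end Score

/-! ### The transport inequality on the line -/

/-- The quotient of the weighted arithmetic mean by the weighted geometric mean of `x` and `y`, with
weights `1 - lam` and `lam`. -/
noncomputable def amGmRatio (lam x y : ℝ) : ℝ :=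
  ((1 - lam) * x + lam * y) / (x ^ (1 - lam) * y ^ lam)

theorem one_le_amGmRatio {lam x y : ℝ} (h0 : 0 < lam) (h1 : lam < 1) (hx : 0 < x) (hy : 0 < y) :
    1 ≤ amGmRatio lam x y := by
  rw [amGmRatio, one_le_div (by positivity)]
  exact Real.geom_mean_le_arith_mean2_weighted (by linarith) h0.le hx.le hy.le (by ring)

theorem eq_of_amGmRatio_eq_one {lam x y : ℝ} (h0 : 0 < lam) (h1 : lam < 1) (hx : 0 < x)
    (hy : 0 < y) (h : amGmRatio lam x y = 1) : x = y := by
  rw [amGmRatio, div_eq_one_iff_eq (by positivity)] at h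
  have := (Real.geom_mean_eq_arith_mean_weighted_iff_of_pos Finset.univ ![1 - lam, lam] ![x, y]
    (by simp [Fin.forall_fin_two, h0, h1]) (by simp) (by simp [Fin.forall_fin_two, hx.le, hy.le])).1
    (by simpa using h.symm)
  exact this 0 (Finset.mem_univ _) 1 (Finset.mem_univ _)

section Line

variable {f g : ℝ → ℝ} {lam : ℝ}

/-- The derivative, at almost every point, of the normal score of the density `f`. -/
noncomputable def scoreDeriv (f : ℝ → ℝ) (x : ℝ) : ℝ := f x / stdGaussianDensity (normalScore f x)

theorem IsPositiveDensity.scoreDeriv_pos (hf : IsPositiveDensity f) (x : ℝ) :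
    0 < scoreDeriv f x :=
  div_pos (hf.pos x) (isPositiveDensity_stdGaussianDensity.pos _)

theorem IsPositiveDensity.measurable_scoreDeriv (hf : IsPositiveDensity f) :
    Measurable (scoreDeriv f) :=
  hf.measurable.div
    (continuous_stdGaussianDensity.comp hf.continuous_normalScore).measurable

theorem IsPositiveDensity.ae_hasDerivAt_normalScore (hf : IsPositiveDensity f) :
    ∀ᵐ x, HasDerivAt (normalScore f) (scoreDeriv f x) x := by
  filter_upwards [hf.ae_hasDerivAt_cdf] with x hx using hf.hasDerivAt_normalScore hx

/-- Change of variable along an increasing map. Only an inequality holds, since the image under `T`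
of the points of differentiability may miss a set of positive measure. -/
theorem lintegral_stdGaussianDensity_comp_le_one {T T' : ℝ → ℝ} (hT : StrictMono T)
    (hT' : ∀ᵐ x, HasDerivAt T (T' x) x) :
    ∫⁻ x, ENNReal.ofReal (T' x) * ENNReal.ofReal (stdGaussianDensity (T x)) ≤ 1 := by
  obtain ⟨s, hs, hsm, hs0⟩ := exists_measurable_superset_of_null hT'
  have hD : ∀ x ∈ sᶜ, HasDerivWithinAt T (T' x) sᶜ x := fun x hx => by
    by_contra h
    exact hx (hs fun h' => h h'.hasDerivWithinAt)
  calc ∫⁻ x, ENNReal.ofReal (T' x) * ENNReal.ofReal (stdGaussianDensity (T x))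
      = ∫⁻ x in sᶜ, ENNReal.ofReal (T' x) * ENNReal.ofReal (stdGaussianDensity (T x)) := by
        rw [setLIntegral_congr (t := univ), setLIntegral_univ]
        exact eventuallyEq_univ.2 (compl_mem_ae_iff.2 hs0)
    _ = ∫⁻ x in T '' sᶜ, ENNReal.ofReal (stdGaussianDensity x) :=
        (lintegral_image_eq_lintegral_deriv_mul_of_monotoneOn hsm.compl hD
          (hT.monotone.monotoneOn _) fun x => ENNReal.ofReal (stdGaussianDensity x)).symm
    _ ≤ 1 := (setLIntegral_le_lintegral _ _).trans
        isPositiveDensity_stdGaussianDensity.lintegral_eq_one.le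

theorem lintegral_comp_inv_mul_sub {a : ℝ} (ha : 0 < a) (c : ℝ) (h : ℝ → ℝ≥0∞)
    (hh : Measurable h) :
    ∫⁻ z, ENNReal.ofReal a⁻¹ * h (a⁻¹ * (z - c)) = ∫⁻ u, h u := by
  have ha' : a⁻¹ ≠ 0 := (inv_pos.2 ha).ne'
  rw [lintegral_const_mul _ (by fun_prop),
    lintegral_sub_right_eq_self (fun z => h (a⁻¹ * z)) c,
    ← lintegral_map (f := h) hh (measurable_const_mul a⁻¹), Real.map_volume_mul_left ha',
    lintegral_smul_measure, smul_eq_mul, ← mul_assoc, ← ENNReal.ofReal_mul (by positivity), inv_inv,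
    abs_of_pos ha, inv_mul_cancel₀ ha.ne', ENNReal.ofReal_one, one_mul]

/-- The Gaussian identity behind the kernel: with `a = √lam` and `b = √(1 - lam)`,
`(a t - b s) ^ 2 = b ^ 2 s ^ 2 + a ^ 2 t ^ 2 - 2 a b s t`. -/
theorem exp_mul_stdGaussianDensity_rpow (h0 : 0 < lam) (h1 : lam < 1) (s t : ℝ) :
    Real.exp (√lam * √(1 - lam) * (s * t)) *
      (stdGaussianDensity s ^ (1 - lam) * stdGaussianDensity t ^ lam) =
      stdGaussianDensity (√lam * t - √(1 - lam) * s) := by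
  have hc : (0 : ℝ) < (√(2 * Real.pi))⁻¹ := by positivity
  have hd (x : ℝ) : stdGaussianDensity x = (√(2 * Real.pi))⁻¹ * Real.exp (-x ^ 2 / 2) := by
    simp [stdGaussianDensity, gaussianPDFReal]
  rw [hd, hd, hd, Real.mul_rpow hc.le (Real.exp_pos _).le, Real.mul_rpow hc.le (Real.exp_pos _).le,
    ← Real.exp_mul, ← Real.exp_mul]
  have hcc : (√(2 * Real.pi))⁻¹ ^ (1 - lam) * (√(2 * Real.pi))⁻¹ ^ lam = (√(2 * Real.pi))⁻¹ := by
    rw [← Real.rpow_add hc]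
    simp
  have hl : √lam ^ 2 = lam := Real.sq_sqrt h0.le
  have hl' : √(1 - lam) ^ 2 = 1 - lam := Real.sq_sqrt (by linarith)
  calc _ = ((√(2 * Real.pi))⁻¹ ^ (1 - lam) * (√(2 * Real.pi))⁻¹ ^ lam) *
        (Real.exp (√lam * √(1 - lam) * (s * t)) * Real.exp (-s ^ 2 / 2 * (1 - lam)) *
          Real.exp (-t ^ 2 / 2 * lam)) := by ring
    _ = _ := by
      rw [hcc, ← Real.exp_add, ← Real.exp_add]
      congr 2
      linear_combination (t ^ 2 / 2) * hl + (s ^ 2 / 2) * hl'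

theorem IsPositiveDensity.exp_mul_amGmRatio_mul (hf : IsPositiveDensity f)
    (hg : IsPositiveDensity g) (h0 : 0 < lam) (h1 : lam < 1) (u v : ℝ) :
    Real.exp (√lam * √(1 - lam) * (normalScore f u * normalScore g v)) *
      amGmRatio lam (scoreDeriv f u) (scoreDeriv g v) * (f u ^ (1 - lam) * g v ^ lam) =
    ((1 - lam) * scoreDeriv f u + lam * scoreDeriv g v) *
      stdGaussianDensity (√lam * normalScore g v - √(1 - lam) * normalScore f u) := by
  have hF := isPositiveDensity_stdGaussianDensity.pos (normalScore f u)
  have hG := isPositiveDensity_stdGaussianDensity.pos (normalScore g v)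
  have hfu : f u ^ (1 - lam) = scoreDeriv f u ^ (1 - lam) *
      stdGaussianDensity (normalScore f u) ^ (1 - lam) := by
    rw [← Real.mul_rpow (hf.scoreDeriv_pos u).le hF.le, scoreDeriv, div_mul_cancel₀ _ hF.ne']
  have hgv : g v ^ lam = scoreDeriv g v ^ lam * stdGaussianDensity (normalScore g v) ^ lam := by
    rw [← Real.mul_rpow (hg.scoreDeriv_pos v).le hG.le, scoreDeriv, div_mul_cancel₀ _ hG.ne']
  rw [← exp_mul_stdGaussianDensity_rpow h0 h1, hfu, hgv, amGmRatio]
  have h2 := (Real.rpow_pos_of_pos (hf.scoreDeriv_pos u) (1 - lam)).ne'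
  have h3 := (Real.rpow_pos_of_pos (hg.scoreDeriv_pos v) lam).ne'
  field_simp

/-- The transport inequality on the line. For a fixed value `z` of `√lam u + √(1 - lam) v`, the
variable `√lam S_g(v) - √(1 - lam) S_f(u)`, where `S` denotes the normal scores, is an increasing
function of `v`; the kernel is the Jacobian of this change of variable times the Gaussian density of
the new variable. -/
theorem IsPositiveDensity.lintegral_kernel_le (hf : IsPositiveDensity f) (hg : IsPositiveDensity g)
    (h0 : 0 < lam) (h1 : lam < 1) {F : ℝ → ℝ≥0∞} (hF : Measurable F) :
    ∫⁻ u, ∫⁻ v, F (√lam * u + √(1 - lam) * v) * ENNReal.ofReal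
      (Real.exp (√lam * √(1 - lam) * (normalScore f u * normalScore g v)) *
        amGmRatio lam (scoreDeriv f u) (scoreDeriv g v) * (f u ^ (1 - lam) * g v ^ lam)) ≤
    ∫⁻ z, F z := by
  set a := √lam
  set b := √(1 - lam)
  have ha : 0 < a := Real.sqrt_pos.2 h0
  have hb : 0 < b := Real.sqrt_pos.2 (by linarith)
  have ha2 : a * a = lam := Real.mul_self_sqrt h0.le
  have hb2 : b * b = 1 - lam := Real.mul_self_sqrt (by linarith)
  have hSf : Measurable (normalScore f) := hf.continuous_normalScore.measurable
  have hSg : Measurable (normalScore g) := hg.continuous_normalScore.measurable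
  have hDf := hf.measurable_scoreDeriv
  have hDg := hg.measurable_scoreDeriv
  have hφ := continuous_stdGaussianDensity.measurable
  let J (u v : ℝ) : ℝ≥0∞ := ENNReal.ofReal (((1 - lam) * scoreDeriv f u + lam * scoreDeriv g v) *
    stdGaussianDensity (a * normalScore g v - b * normalScore f u))
  have hJ : Measurable (Function.uncurry J) := by
    unfold J Function.uncurry
    fun_prop
  have hint (z : ℝ) : ∫⁻ v, ENNReal.ofReal a⁻¹ * J (a⁻¹ * (z - b * v)) v ≤ 1 := by
    have hmono : StrictMono fun v => a * normalScore g v - b * normalScore f (a⁻¹ * (z - b * v)) :=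
      fun v w hvw => sub_lt_sub (mul_lt_mul_of_pos_left (hg.strictMono_normalScore hvw) ha)
        (mul_lt_mul_of_pos_left (hf.strictMono_normalScore (by gcongr)) hb)
    have hqmp : Measure.QuasiMeasurePreserving (fun v => a⁻¹ * (z - b * v)) := by
      refine ⟨by fun_prop, ?_⟩
      have : (fun v => a⁻¹ * (z - b * v)) = (fun v => a⁻¹ * z + v) ∘ fun v => (-(a⁻¹ * b)) * v := by
        ext v
        simp only [Function.comp_apply]
        ring
      rw [this, ← Measure.map_map (by fun_prop) (by fun_prop),
        Real.map_volume_mul_left (by simp [ha.ne', hb.ne']), Measure.map_smul, map_add_left_eq_self]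
      exact Measure.smul_absolutelyContinuous
    have hderiv : ∀ᵐ v, HasDerivAt
        (fun v => a * normalScore g v - b * normalScore f (a⁻¹ * (z - b * v)))
        (a⁻¹ * ((1 - lam) * scoreDeriv f (a⁻¹ * (z - b * v)) + lam * scoreDeriv g v)) v := by
      filter_upwards [hg.ae_hasDerivAt_normalScore, hqmp.ae hf.ae_hasDerivAt_normalScore]
        with v hv hv'
      have h3 : HasDerivAt (fun v => a⁻¹ * (z - b * v)) (a⁻¹ * -b) v := by
        simpa using (((hasDerivAt_id v).const_mul b).const_sub z).const_mul a⁻¹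
      have h4 := (hv.const_mul a).fun_sub ((hv'.comp v h3).const_mul b)
      convert! h4 using 1
      rw [← hb2, ← ha2]
      field_simp
      ring
    refine le_trans (lintegral_mono fun v => le_of_eq ?_)
      (lintegral_stdGaussianDensity_comp_le_one hmono hderiv)
    have := hf.scoreDeriv_pos (a⁻¹ * (z - b * v))
    have := hg.scoreDeriv_pos v
    have h1' : 0 < 1 - lam := by linarith
    rw [← ENNReal.ofReal_mul (by positivity), ← ENNReal.ofReal_mul (by positivity), mul_assoc]
  calc _ = ∫⁻ u, ∫⁻ v, F (a * u + b * v) * J u v := by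
        refine lintegral_congr fun u => lintegral_congr fun v => ?_
        exact congrArg (fun r => F (a * u + b * v) * ENNReal.ofReal r)
          (hf.exp_mul_amGmRatio_mul hg h0 h1 u v)
    _ = ∫⁻ v, ∫⁻ u, F (a * u + b * v) * J u v :=
        lintegral_lintegral_swap (by fun_prop)
    -- For fixed `v`, the variable `u` is replaced by `z = a * u + b * v`.
    _ = ∫⁻ v, ∫⁻ z, F z * (ENNReal.ofReal a⁻¹ * J (a⁻¹ * (z - b * v)) v) := by
        refine lintegral_congr fun v => ?_
        rw [← lintegral_comp_inv_mul_sub ha (b * v) _ (by fun_prop)]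
        refine lintegral_congr fun z => ?_
        rw [mul_inv_cancel_left₀ ha.ne', sub_add_cancel]
        ring
    _ = ∫⁻ z, ∫⁻ v, F z * (ENNReal.ofReal a⁻¹ * J (a⁻¹ * (z - b * v)) v) :=
        lintegral_lintegral_swap (by fun_prop)
    _ ≤ ∫⁻ z, F z := by
        refine lintegral_mono fun z => ?_
        rw [lintegral_const_mul _ (by fun_prop)]
        exact mul_le_of_le_one_right' (hint z)

/-- If the arithmetic and geometric means of the score derivatives agree almost everywhere, then
both densities are Gaussian with the same variance: a function of `u` which agrees with a function
of `v` is constant. -/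
theorem IsPositiveDensity.gaussian_of_amGmRatio_eq_one (hf : IsPositiveDensity f)
    (hg : IsPositiveDensity g) (h0 : 0 < lam) (h1 : lam < 1)
    (h : ∀ᵐ p ∂(densityMeasure f).prod (densityMeasure g),
      amGmRatio lam (scoreDeriv f p.1) (scoreDeriv g p.2) = 1) :
    ∃ m₁ m₂ v, densityMeasure f = gaussianReal m₁ v ∧ densityMeasure g = gaussianReal m₂ v := by
  have := hf.isProbabilityMeasure
  have := hg.isProbabilityMeasure
  have hfg : ∀ᵐ u, ∀ᵐ v, scoreDeriv f u = scoreDeriv g v := by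
    filter_upwards [hf.volume_absolutelyContinuous.ae_le (Measure.ae_ae_of_ae_prod h)] with u hu
    filter_upwards [hg.volume_absolutelyContinuous.ae_le hu] with v hv
    exact eq_of_amGmRatio_eq_one h0 h1 (hf.scoreDeriv_pos u) (hg.scoreDeriv_pos v) hv
  obtain ⟨u₀, hu₀⟩ := hfg.exists
  have hk := hf.scoreDeriv_pos u₀
  have hg' : ∀ᵐ v, g v = scoreDeriv f u₀ * stdGaussianDensity (normalScore g v) := by
    filter_upwards [hu₀] with v hv
    rw [hv, scoreDeriv, div_mul_cancel₀ _ (isPositiveDensity_stdGaussianDensity.pos _).ne']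
  have hf' : ∀ᵐ u, f u = scoreDeriv f u₀ * stdGaussianDensity (normalScore f u) := by
    filter_upwards [hfg] with u hu
    obtain ⟨v, hv, hv'⟩ := (hu.and hu₀).exists
    rw [hv', ← hv, scoreDeriv, div_mul_cancel₀ _ (isPositiveDensity_stdGaussianDensity.pos _).ne']
  obtain ⟨m₁, hm₁⟩ := hf.eq_gaussianReal_of_ae_eq hk hf'
  obtain ⟨m₂, hm₂⟩ := hg.eq_gaussianReal_of_ae_eq hk hg'
  exact ⟨m₁, m₂, _, hm₁, hm₂⟩

end Line

/-! ### Transport kernels -/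

/-- A transport kernel for the densities `f` and `g`: a function `M` with mean zero and a function
`ρ ≥ 1` for which the integral of
`F (√lam x + √(1 - lam) y) exp (M (x, y)) ρ (x, y) f(x)^(1 - lam) g(y)^lam` is at most the integral
of `F`, for every measurable `F ≥ 0`. Moreover `ρ` detects Gaussian laws: if `ρ = 1` almost
everywhere, then `ℓ` has Gaussian distributions of the same (possibly zero) variance under both
densities. -/
def HasTransportKernel {E : Type*} [MeasureSpace E] [AddCommGroup E] [Module ℝ E] (lam : ℝ)
    (ℓ : E → ℝ) (f g : E → ℝ) : Prop :=
  ∃ M ρ : E × E → ℝ, Measurable M ∧ Measurable ρ ∧ (∀ p, 1 ≤ ρ p) ∧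
    Integrable M ((densityMeasure f).prod (densityMeasure g)) ∧
    ∫ p, M p ∂(densityMeasure f).prod (densityMeasure g) = 0 ∧
    (∀ F : E → ℝ≥0∞, Measurable F →
      ∫⁻ x, ∫⁻ y, F (√lam • x + √(1 - lam) • y) *
        ENNReal.ofReal (Real.exp (M (x, y)) * ρ (x, y) * (f x ^ (1 - lam) * g y ^ lam)) ≤
      ∫⁻ z, F z) ∧
    ((∀ᵐ p ∂(densityMeasure f).prod (densityMeasure g), ρ p = 1) →
      ∃ m₁ m₂ v, (densityMeasure f).map ℓ = gaussianReal m₁ v ∧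
        (densityMeasure g).map ℓ = gaussianReal m₂ v)

theorem integrable_of_map_eq_gaussianReal {E : Type*} [MeasurableSpace E] {μ : Measure E}
    {S : E → ℝ} (hS : Measurable S) (h : μ.map S = gaussianReal 0 1) :
    Integrable S μ ∧ ∫ x, S x ∂μ = 0 := by
  constructor
  · have : Integrable id (μ.map S) := by
      rw [h]
      exact IsGaussian.integrable_id
    exact (integrable_map_measure aestronglyMeasurable_id hS.aemeasurable).1 this
  · have := integral_map (μ := μ) hS.aemeasurable (f := id) aestronglyMeasurable_id
    rw [h] at this
    simpa using this.symm

/-- On the line, `M` is a multiple of the product of the normal scores; it has mean zero because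
these are independent and centred under the product law. -/
theorem hasTransportKernel_real {lam : ℝ} (h0 : 0 < lam) (h1 : lam < 1) {f g : ℝ → ℝ}
    (hf : IsPositiveDensity f) (hg : IsPositiveDensity g) : HasTransportKernel lam id f g := by
  have := hf.isProbabilityMeasure
  have := hg.isProbabilityMeasure
  have hSf : Measurable (normalScore f) := hf.continuous_normalScore.measurable
  have hSg : Measurable (normalScore g) := hg.continuous_normalScore.measurable
  have hDf := hf.measurable_scoreDeriv
  have hDg := hg.measurable_scoreDeriv
  obtain ⟨hIf, hEf⟩ := integrable_of_map_eq_gaussianReal hSf hf.map_normalScore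
  obtain ⟨hIg, -⟩ := integrable_of_map_eq_gaussianReal hSg hg.map_normalScore
  refine ⟨fun p => √lam * √(1 - lam) * (normalScore f p.1 * normalScore g p.2),
    fun p => amGmRatio lam (scoreDeriv f p.1) (scoreDeriv g p.2), by fun_prop, ?_,
    fun p => one_le_amGmRatio h0 h1 (hf.scoreDeriv_pos _) (hg.scoreDeriv_pos _),
    (hIf.mul_prod hIg).const_mul _, ?_, fun F hF => hf.lintegral_kernel_le hg h0 h1 hF,
    fun h => ?_⟩
  · unfold amGmRatio
    fun_prop
  · rw [integral_const_mul, integral_prod_mul, hEf]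
    simp
  · simpa using hf.gaussian_of_amGmRatio_eq_one hg h0 h1 h

theorem map_densityMeasure_comp {E E' : Type*} [MeasureSpace E] [MeasureSpace E']
    (e : E ≃ᵐ E') (he : MeasurePreserving e) (f : E' → ℝ) :
    (densityMeasure (f ∘ e)).map e = densityMeasure f := by
  ext s hs
  rw [Measure.map_apply e.measurable hs, densityMeasure, densityMeasure,
    withDensity_apply _ (e.measurable hs), withDensity_apply _ hs]
  exact he.setLIntegral_comp_preimage_emb e.measurableEmbedding
    (fun x => ENNReal.ofReal (f x)) s

theorem IsPositiveDensity.comp_measurableEquiv {E E' : Type*} [MeasureSpace E] [MeasureSpace E']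
    {f : E' → ℝ} (hf : IsPositiveDensity f)
    (e : E ≃ᵐ E') (he : MeasurePreserving e) : IsPositiveDensity (f ∘ e) :=
  ⟨hf.measurable.comp e.measurable, fun x => hf.pos _, by
    rw [← hf.lintegral_eq_one]
    exact he.lintegral_comp_emb e.measurableEmbedding (fun x => ENNReal.ofReal (f x))⟩

section Transfer

variable {E E' : Type*} [MeasureSpace E] [AddCommGroup E] [Module ℝ E]
  [MeasureSpace E'] [AddCommGroup E'] [Module ℝ E'] {lam : ℝ}

theorem HasTransportKernel.congr {ℓ f g f' g' : E → ℝ} (hf : f =ᵐ[volume] f')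
    (hg : g =ᵐ[volume] g') (h : HasTransportKernel lam ℓ f' g') :
    HasTransportKernel lam ℓ f g := by
  have hμ : densityMeasure f = densityMeasure f' :=
    withDensity_congr_ae (hf.fun_comp ENNReal.ofReal)
  have hν : densityMeasure g = densityMeasure g' :=
    withDensity_congr_ae (hg.fun_comp ENNReal.ofReal)
  obtain ⟨M, ρ, hM, hρ, hρ1, hI, hE, hF, hG⟩ := h
  refine ⟨M, ρ, hM, hρ, hρ1, by rwa [hμ, hν], by rwa [hμ, hν], fun F hFm => ?_, by rwa [hμ, hν]⟩
  refine le_trans (le_of_eq ?_) (hF F hFm)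
  refine lintegral_congr_ae ?_
  filter_upwards [hf] with x hx
  refine lintegral_congr_ae ?_
  filter_upwards [hg] with y hy
  rw [hx, hy]

theorem HasTransportKernel.of_comp {ℓ : E → ℝ} {f g : E' → ℝ} (hf : IsPositiveDensity f)
    (hg : IsPositiveDensity g) (e : E ≃ᵐ E') (he : MeasurePreserving e)
    (hlin : ∀ (a b : ℝ) (x y : E), e (a • x + b • y) = a • e x + b • e y) (hℓ : Measurable ℓ)
    (h : HasTransportKernel lam ℓ (f ∘ e) (g ∘ e)) :
    HasTransportKernel lam (ℓ ∘ e.symm) f g := by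
  have := hf.isProbabilityMeasure
  have := hg.isProbabilityMeasure
  have := (hf.comp_measurableEquiv e he).isProbabilityMeasure
  have := (hg.comp_measurableEquiv e he).isProbabilityMeasure
  obtain ⟨M, ρ, hM, hρ, hρ1, hI, hE, hF, hG⟩ := h
  have hμ : (densityMeasure f).map e.symm = densityMeasure (f ∘ e) := by
    rw [← map_densityMeasure_comp e he f, MeasurableEquiv.map_symm_map]
  have hν : (densityMeasure g).map e.symm = densityMeasure (g ∘ e) := by
    rw [← map_densityMeasure_comp e he g, MeasurableEquiv.map_symm_map]
  let e2 : E' × E' ≃ᵐ E × E := e.symm.prodCongr e.symm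
  have he2 : ((densityMeasure f).prod (densityMeasure g)).map e2 =
      (densityMeasure (f ∘ e)).prod (densityMeasure (g ∘ e)) := by
    rw [← hμ, ← hν, Measure.map_prod_map _ _ e.symm.measurable e.symm.measurable]
    rfl
  rw [← he2] at hI hE hG
  refine ⟨M ∘ e2, ρ ∘ e2, hM.comp e2.measurable, hρ.comp e2.measurable, fun p => hρ1 _,
    (e2.measurableEmbedding.integrable_map_iff).1 hI, ?_, fun F hFm => ?_, fun h => ?_⟩
  · rw [← hE, e2.measurableEmbedding.integral_map]
    rfl
  · rw [← he.lintegral_comp_emb e.measurableEmbedding F]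
    refine le_trans (le_of_eq ?_) (hF (F ∘ e) (hFm.comp e.measurable))
    rw [← he.lintegral_comp_emb e.measurableEmbedding]
    refine lintegral_congr fun x => ?_
    rw [← he.lintegral_comp_emb e.measurableEmbedding]
    refine lintegral_congr fun y => ?_
    have hxy : e2 (e x, e y) = (x, y) := by simp [e2, MeasurableEquiv.prodCongr]
    simp only [Function.comp_apply, hlin, hxy]
  · rw [← Measure.map_map hℓ e.symm.measurable, ← Measure.map_map hℓ e.symm.measurable, hμ, hν]
    exact hG ((e2.measurableEmbedding.ae_map_iff).2 h)

end Transfer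

/-! ### Adding a coordinate -/

/-- The normal score of a density depending on a parameter is jointly measurable: its sublevel sets
are sublevel sets of the distribution function. -/
theorem measurable_uncurry_normalScore {E : Type*} [MeasurableSpace E] {f : E → ℝ → ℝ}
    (hf : Measurable (Function.uncurry f)) (hfd : ∀ x, IsPositiveDensity (f x)) :
    Measurable (Function.uncurry fun x => normalScore (f x)) := by
  have hcdf : Measurable fun p : E × ℝ => cdf (densityMeasure (f p.1)) p.2 := by
    have h1 (p : E × ℝ) : cdf (densityMeasure (f p.1)) p.2 =
        (∫⁻ t, {q : (E × ℝ) × ℝ | q.2 ≤ q.1.2}.indicator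
          (fun q => ENNReal.ofReal (f q.1.1 q.2)) (p, t)).toReal := by
      have := (hfd p.1).isProbabilityMeasure
      rw [cdf_eq_real, measureReal_def, densityMeasure, withDensity_apply _ measurableSet_Iic,
        ← lintegral_indicator measurableSet_Iic]
      rfl
    rw [funext h1]
    refine (Measurable.lintegral_prod_right ?_).ennreal_toReal
    refine Measurable.indicator ?_ (measurableSet_le (by fun_prop) (by fun_prop))
    have : Measurable fun q : (E × ℝ) × ℝ => Function.uncurry f (q.1.1, q.2) := by fun_prop
    exact this.ennreal_ofReal
  refine measurable_of_Iic fun a => ?_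
  have : (Function.uncurry fun x => normalScore (f x)) ⁻¹' Iic a =
      {p : E × ℝ | cdf (densityMeasure (f p.1)) p.2 ≤ stdGaussianCDF a} := by
    ext p
    exact (hfd p.1).normalScore_le_iff p.2 a
  rw [this]
  exact measurableSet_le hcdf measurable_const

section AddCoordinate

variable {E : Type*} [MeasureSpace E] [SigmaFinite (volume : Measure E)]

/-- Disintegration of a positive density: up to a null set, `f` is the product of a positive density
in `x` and of positive conditional densities in `t`. -/
theorem IsPositiveDensity.exists_conditional {f : ℝ × E → ℝ} (hf : IsPositiveDensity f) :
    ∃ (m : E → ℝ) (c : E → ℝ → ℝ), IsPositiveDensity m ∧ Measurable (Function.uncurry c) ∧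
      (∀ x, IsPositiveDensity (c x)) ∧ f =ᵐ[volume] fun p => m p.2 * c p.2 p.1 := by
  classical
  have hfm := hf.measurable
  let I (x : E) : ℝ≥0∞ := ∫⁻ t, ENNReal.ofReal (f (t, x))
  have hI : Measurable I :=
    Measurable.lintegral_prod_left' (f := fun p : ℝ × E => ENNReal.ofReal (f p)) (by fun_prop)
  have hI1 : ∫⁻ x, I x = 1 := by
    rw [← hf.lintegral_eq_one, Measure.volume_eq_prod, lintegral_prod_symm _ (by fun_prop)]
  have hIfin : ∀ᵐ x, I x < ∞ := ae_lt_top hI (by simp [hI1])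
  have hI0 (x : E) : I x ≠ 0 := by
    intro h
    rw [lintegral_eq_zero_iff (by fun_prop)] at h
    obtain ⟨t, ht⟩ := h.exists
    exact (ENNReal.ofReal_pos.2 (hf.pos (t, x))).ne' ht
  have hs : MeasurableSet {x | I x < ∞} := measurableSet_lt hI measurable_const
  -- The marginal density `I` may be infinite on a null set; there any positive values will do.
  refine ⟨fun x => if I x < ∞ then (I x).toReal else 1,
    fun x t => if I x < ∞ then (I x).toReal⁻¹ * f (t, x) else stdGaussianDensity t,
    ⟨?_, fun x => ?_, ?_⟩, ?_, fun x => ?_, ?_⟩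
  · exact Measurable.ite hs hI.ennreal_toReal measurable_const
  · split_ifs with h
    · exact ENNReal.toReal_pos (hI0 x) h.ne
    · exact one_pos
  · rw [← hI1]
    refine lintegral_congr_ae ?_
    filter_upwards [hIfin] with x hx
    rw [if_pos hx, ENNReal.ofReal_toReal hx.ne]
  · have hφ := continuous_stdGaussianDensity.measurable
    exact Measurable.ite (measurable_fst hs) (by fun_prop) (by fun_prop)
  · by_cases h : I x < ∞
    · have hpos : 0 < (I x).toReal := ENNReal.toReal_pos (hI0 x) h.ne
      simp only [h, if_true]
      refine ⟨by fun_prop, fun t => mul_pos (inv_pos.2 hpos) (hf.pos _), ?_⟩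
      simp_rw [ENNReal.ofReal_mul (inv_pos.2 hpos).le]
      rw [lintegral_const_mul _ (by fun_prop), ENNReal.ofReal_inv_of_pos hpos,
        ENNReal.ofReal_toReal h.ne]
      exact ENNReal.inv_mul_cancel (hI0 x) h.ne
    · simp only [h, if_false]
      exact isPositiveDensity_stdGaussianDensity
  · have : ∀ᵐ p : ℝ × E, I p.2 < ∞ := Measure.quasiMeasurePreserving_snd.ae hIfin
    filter_upwards [this] with p hp
    have hpos : 0 < (I p.2).toReal := ENNReal.toReal_pos (hI0 _) hp.ne
    simp only [hp, if_true]
    rw [mul_inv_cancel_left₀ hpos.ne']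

variable {m : E → ℝ} {c : E → ℝ → ℝ}

theorem lintegral_conditional (hm : IsPositiveDensity m) (hc : Measurable (Function.uncurry c))
    {h : ℝ × E → ℝ≥0∞} (hh : Measurable h) :
    ∫⁻ p, h p ∂densityMeasure (fun p : ℝ × E => m p.2 * c p.2 p.1) =
      ∫⁻ x, (∫⁻ t, h (t, x) ∂densityMeasure (c x)) ∂densityMeasure m := by
  have hmm := hm.measurable
  have hc' : Measurable fun p : ℝ × E => c p.2 p.1 := hc.comp measurable_swap
  have hcx (x : E) : Measurable (c x) := hc.comp measurable_prodMk_left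
  rw [densityMeasure, lintegral_withDensity_eq_lintegral_mul _ (by fun_prop) hh,
    Measure.volume_eq_prod, lintegral_prod_symm _ (by fun_prop), hm.lintegral_densityMeasure]
  refine lintegral_congr fun x => ?_
  rw [densityMeasure, lintegral_withDensity_eq_lintegral_mul _ (by fun_prop) (by fun_prop),
    ← lintegral_const_mul _ (by fun_prop)]
  refine lintegral_congr fun t => ?_
  simp only [Pi.mul_apply]
  rw [ENNReal.ofReal_mul (hm.pos x).le, mul_assoc]

theorem map_snd_conditional (hm : IsPositiveDensity m) (hc : Measurable (Function.uncurry c))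
    (hcd : ∀ x, IsPositiveDensity (c x)) :
    (densityMeasure fun p : ℝ × E => m p.2 * c p.2 p.1).map Prod.snd = densityMeasure m := by
  ext s hs
  rw [← lintegral_indicator_one hs, ← lintegral_indicator_one hs,
    lintegral_map (measurable_one.indicator hs) measurable_snd,
    lintegral_conditional (h := fun p => s.indicator 1 p.2) hm hc
      ((measurable_one.indicator hs).comp measurable_snd)]
  refine lintegral_congr fun x => ?_
  have := (hcd x).isProbabilityMeasure
  simp

theorem map_normalScore_conditional (hm : IsPositiveDensity m)
    (hc : Measurable (Function.uncurry c)) (hcd : ∀ x, IsPositiveDensity (c x)) :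
    (densityMeasure fun p : ℝ × E => m p.2 * c p.2 p.1).map
      (fun p => normalScore (c p.2) p.1) = gaussianReal 0 1 := by
  have := hm.isProbabilityMeasure
  have hS : Measurable fun p : ℝ × E => normalScore (c p.2) p.1 :=
    (measurable_uncurry_normalScore hc hcd).comp (g := Function.uncurry fun x => normalScore (c x))
      (f := fun p : ℝ × E => (p.2, p.1)) (by fun_prop)
  ext s hs
  have hs' : Measurable (s.indicator (1 : ℝ → ℝ≥0∞)) := measurable_one.indicator hs
  rw [← lintegral_indicator_one hs, ← lintegral_indicator_one hs,
    lintegral_map hs' hS,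
    lintegral_conditional (h := fun p => s.indicator 1 (normalScore (c p.2) p.1)) hm hc
      (hs'.comp hS)]
  have (x : E) : ∫⁻ t, s.indicator (1 : ℝ → ℝ≥0∞) (normalScore (c x) t) ∂densityMeasure (c x) =
      ∫⁻ t, s.indicator 1 t ∂gaussianReal 0 1 := by
    rw [← (hcd x).map_normalScore, lintegral_map hs' (hcd x).continuous_normalScore.measurable]
  simp only [this]
  simp

/-- The transport inequality for densities on `ℝ × E` in factorized form: for fixed `x` and `y` the
one-dimensional inequality applies to the conditional densities, its factor `amGmRatio` being
bounded below by one; the inequality on `E` is then applied to the integral of `F` over the first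
coordinate. -/
theorem lintegral_prod_kernel_le [AddCommGroup E] [Module ℝ E] [MeasurableAdd₂ E]
    [MeasurableConstSMul ℝ E] {lam : ℝ} (h0 : 0 < lam) (h1 : lam < 1) {n : E → ℝ} {d : E → ℝ → ℝ}
    (hm : IsPositiveDensity m) (hn : IsPositiveDensity n)
    (hc : Measurable (Function.uncurry c)) (hd : Measurable (Function.uncurry d))
    (hcd : ∀ x, IsPositiveDensity (c x)) (hdd : ∀ x, IsPositiveDensity (d x))
    {M ρ : E × E → ℝ} (hM : Measurable M) (hρ : Measurable ρ) (hρ1 : ∀ p, 1 ≤ ρ p)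
    (hF : ∀ F : E → ℝ≥0∞, Measurable F →
      ∫⁻ x, ∫⁻ y, F (√lam • x + √(1 - lam) • y) *
        ENNReal.ofReal (Real.exp (M (x, y)) * ρ (x, y) * (m x ^ (1 - lam) * n y ^ lam)) ≤
      ∫⁻ z, F z) {F : ℝ × E → ℝ≥0∞} (hFm : Measurable F) :
    ∫⁻ p : ℝ × E, ∫⁻ q : ℝ × E, F (√lam • p + √(1 - lam) • q) * ENNReal.ofReal
      (Real.exp (M (p.2, q.2) + √lam * √(1 - lam) *
          (normalScore (c p.2) p.1 * normalScore (d q.2) q.1)) * ρ (p.2, q.2) *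
        ((m p.2 * c p.2 p.1) ^ (1 - lam) * (n q.2 * d q.2 q.1) ^ lam)) ≤ ∫⁻ z, F z := by
  have hmm := hm.measurable
  have hnm := hn.measurable
  have hSc := measurable_uncurry_normalScore hc hcd
  have hSd := measurable_uncurry_normalScore hd hdd
  let A (x y : E) : ℝ≥0∞ :=
    ENNReal.ofReal (Real.exp (M (x, y)) * ρ (x, y) * (m x ^ (1 - lam) * n y ^ lam))
  let B (x y : E) (u v : ℝ) : ℝ≥0∞ := ENNReal.ofReal
    (Real.exp (√lam * √(1 - lam) * (normalScore (c x) u * normalScore (d y) v)) *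
      (c x u ^ (1 - lam) * d y v ^ lam))
  let C (x y : E) (u v : ℝ) : ℝ≥0∞ := A x y *
    (F (√lam * u + √(1 - lam) * v, √lam • x + √(1 - lam) • y) * B x y u v)
  have hA : Measurable fun p : E × E => A p.1 p.2 := by
    unfold A
    fun_prop
  have hB : Measurable fun p : (E × E) × (ℝ × ℝ) => B p.1.1 p.1.2 p.2.1 p.2.2 := by
    have h1 : Measurable fun p : (E × E) × (ℝ × ℝ) => normalScore (c p.1.1) p.2.1 :=
      hSc.comp (g := Function.uncurry fun x => normalScore (c x))
        (f := fun p : (E × E) × (ℝ × ℝ) => (p.1.1, p.2.1)) (by fun_prop)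
    have h2 : Measurable fun p : (E × E) × (ℝ × ℝ) => normalScore (d p.1.2) p.2.2 :=
      hSd.comp (g := Function.uncurry fun x => normalScore (d x))
        (f := fun p : (E × E) × (ℝ × ℝ) => (p.1.2, p.2.2)) (by fun_prop)
    have h3 : Measurable fun p : (E × E) × (ℝ × ℝ) => c p.1.1 p.2.1 :=
      hc.comp (g := Function.uncurry c)
        (f := fun p : (E × E) × (ℝ × ℝ) => (p.1.1, p.2.1)) (by fun_prop)
    have h4 : Measurable fun p : (E × E) × (ℝ × ℝ) => d p.1.2 p.2.2 :=
      hd.comp (g := Function.uncurry d)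
        (f := fun p : (E × E) × (ℝ × ℝ) => (p.1.2, p.2.2)) (by fun_prop)
    unfold B
    fun_prop
  have hC : Measurable fun p : (E × E) × (ℝ × ℝ) => C p.1.1 p.1.2 p.2.1 p.2.2 := by
    have hF' : Measurable fun p : (E × E) × (ℝ × ℝ) =>
        F (√lam * p.2.1 + √(1 - lam) * p.2.2, √lam • p.1.1 + √(1 - lam) • p.1.2) :=
      hFm.comp (by fun_prop)
    exact (hA.comp measurable_fst).mul (hF'.mul hB)
  have hint (x y : E) : ∫⁻ u, ∫⁻ v, C x y u v ≤
      A x y * ∫⁻ z, F (z, √lam • x + √(1 - lam) • y) := by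
    have hBxy : Measurable fun p : ℝ × ℝ => B x y p.1 p.2 :=
      hB.comp (f := fun p : ℝ × ℝ => ((x, y), p)) measurable_prodMk_left
    have h2 : Measurable fun p : ℝ × ℝ =>
        F (√lam * p.1 + √(1 - lam) * p.2, √lam • x + √(1 - lam) • y) * B x y p.1 p.2 := by
      fun_prop
    have h3 (u : ℝ) : ∫⁻ v, C x y u v = A x y *
        ∫⁻ v, F (√lam * u + √(1 - lam) * v, √lam • x + √(1 - lam) • y) * B x y u v :=
      lintegral_const_mul _ (h2.comp measurable_prodMk_left)
    rw [lintegral_congr h3, lintegral_const_mul _ h2.lintegral_prod_right']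
    refine mul_le_mul_right ?_ _
    refine le_trans ?_ ((hcd x).lintegral_kernel_le (hdd y) h0 h1
      (F := fun z => F (z, √lam • x + √(1 - lam) • y)) (by fun_prop))
    refine lintegral_mono fun u => lintegral_mono fun v => ?_
    dsimp only [B]
    gcongr
    · exact mul_nonneg (Real.rpow_nonneg ((hcd x).pos u).le _)
        (Real.rpow_nonneg ((hdd y).pos v).le _)
    · exact le_mul_of_one_le_right (Real.exp_pos _).le
        (one_le_amGmRatio h0 h1 ((hcd x).scoreDeriv_pos u) ((hdd y).scoreDeriv_pos v))
  have hCuv (x : E) (u : ℝ) : Measurable fun q : ℝ × E => C x q.2 u q.1 :=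
    hC.comp (f := fun q : ℝ × E => ((x, q.2), (u, q.1))) (by fun_prop)
  have hCxu : Measurable fun p : ℝ × E => ∫⁻ y, ∫⁻ v, C p.2 y p.1 v := by
    refine Measurable.lintegral_prod_right' (f := fun r : (ℝ × E) × E => ∫⁻ v, C r.1.2 r.2 r.1.1 v)
      ?_
    exact Measurable.lintegral_prod_right'
      (f := fun r : ((ℝ × E) × E) × ℝ => C r.1.1.2 r.1.2 r.1.1.1 r.2)
      (hC.comp (f := fun r : ((ℝ × E) × E) × ℝ => ((r.1.1.2, r.1.2), (r.1.1.1, r.2)))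
        (by fun_prop))
  have hCyu (x : E) : Measurable fun p : ℝ × E => ∫⁻ v, C x p.2 p.1 v :=
    Measurable.lintegral_prod_right' (f := fun r : (ℝ × E) × ℝ => C x r.1.2 r.1.1 r.2)
      (hC.comp (f := fun r : (ℝ × E) × ℝ => ((x, r.1.2), (r.1.1, r.2))) (by fun_prop))
  have hG : Measurable fun w : E => ∫⁻ z, F (z, w) := hFm.lintegral_prod_left'
  calc _ = ∫⁻ p : ℝ × E, ∫⁻ q : ℝ × E, C p.2 q.2 p.1 q.1 := by
        refine lintegral_congr fun p => lintegral_congr fun q => ?_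
        have e1 : ENNReal.ofReal (Real.exp (M (p.2, q.2) + √lam * √(1 - lam) *
            (normalScore (c p.2) p.1 * normalScore (d q.2) q.1)) * ρ (p.2, q.2) *
            ((m p.2 * c p.2 p.1) ^ (1 - lam) * (n q.2 * d q.2 q.1) ^ lam)) =
            A p.2 q.2 * B p.2 q.2 p.1 q.1 := by
          have h1 := hm.pos p.2
          have h2 := hn.pos q.2
          have h3 := (hcd p.2).pos p.1
          have h4 := (hdd q.2).pos q.1
          have h5 := zero_lt_one.trans_le (hρ1 (p.2, q.2))
          dsimp only [A, B]
          rw [← ENNReal.ofReal_mul (by positivity), Real.exp_add, Real.mul_rpow h1.le h3.le,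
            Real.mul_rpow h2.le h4.le]
          congr 1
          ring
        rw [e1, mul_left_comm]
        rfl
    _ = ∫⁻ x, ∫⁻ u, ∫⁻ y, ∫⁻ v, C x y u v := by
        have h2 (p : ℝ × E) : ∫⁻ q : ℝ × E, C p.2 q.2 p.1 q.1 = ∫⁻ y, ∫⁻ v, C p.2 y p.1 v := by
          rw [Measure.volume_eq_prod, lintegral_prod_symm _ (hCuv p.2 p.1).aemeasurable]
        rw [lintegral_congr h2, Measure.volume_eq_prod, lintegral_prod_symm _ hCxu.aemeasurable]
    _ = ∫⁻ x, ∫⁻ y, ∫⁻ u, ∫⁻ v, C x y u v :=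
        lintegral_congr fun x => lintegral_lintegral_swap (hCyu x).aemeasurable
    _ ≤ ∫⁻ x, ∫⁻ y, (∫⁻ z, F (z, √lam • x + √(1 - lam) • y)) * A x y := by
        refine lintegral_mono fun x => lintegral_mono fun y => (hint x y).trans_eq (mul_comm _ _)
    _ ≤ ∫⁻ w, ∫⁻ z, F (z, w) := hF _ hG
    _ = ∫⁻ z, F z := by
        rw [Measure.volume_eq_prod, lintegral_prod_symm _ hFm.aemeasurable]

/-- Adding a coordinate: the kernel for the densities on `E` is multiplied by the one-dimensional
kernels of the conditional densities. -/
theorem HasTransportKernel.prod [AddCommGroup E] [Module ℝ E] [MeasurableAdd₂ E]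
    [MeasurableConstSMul ℝ E] {lam : ℝ} (h0 : 0 < lam)
    (h1 : lam < 1) {ℓ : E → ℝ} (hℓ : Measurable ℓ)
    (hE : ∀ f g : E → ℝ, IsPositiveDensity f → IsPositiveDensity g → HasTransportKernel lam ℓ f g)
    {f g : ℝ × E → ℝ} (hf : IsPositiveDensity f) (hg : IsPositiveDensity g) :
    HasTransportKernel lam (ℓ ∘ Prod.snd) f g := by
  obtain ⟨m, c, hm, hc, hcd, hfmc⟩ := hf.exists_conditional
  obtain ⟨n, d, hn, hd, hdd, hgnd⟩ := hg.exists_conditional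
  refine HasTransportKernel.congr hfmc hgnd ?_
  obtain ⟨M, ρ, hM, hρ, hρ1, hI, hE0, hF, hG⟩ := hE m n hm hn
  have := hm.isProbabilityMeasure
  have := hn.isProbabilityMeasure
  have hSc : Measurable fun p : ℝ × E => normalScore (c p.2) p.1 :=
    (measurable_uncurry_normalScore hc hcd).comp (g := Function.uncurry fun x => normalScore (c x))
      (f := fun p : ℝ × E => (p.2, p.1)) (by fun_prop)
  have hSd : Measurable fun p : ℝ × E => normalScore (d p.2) p.1 :=
    (measurable_uncurry_normalScore hd hdd).comp (g := Function.uncurry fun x => normalScore (d x))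
      (f := fun p : ℝ × E => (p.2, p.1)) (by fun_prop)
  have hμ := map_snd_conditional hm hc hcd
  have hν := map_snd_conditional hn hd hdd
  obtain ⟨hIc, hEc⟩ := integrable_of_map_eq_gaussianReal hSc
    (map_normalScore_conditional hm hc hcd)
  obtain ⟨hId, -⟩ := integrable_of_map_eq_gaussianReal hSd
    (map_normalScore_conditional hn hd hdd)
  have hK (F : ℝ × E → ℝ≥0∞) (hFm : Measurable F) :=
    lintegral_prod_kernel_le h0 h1 hm hn hc hd hcd hdd hM hρ hρ1 hF hFm
  unfold HasTransportKernel
  generalize densityMeasure (fun p : ℝ × E => m p.2 * c p.2 p.1) = μ at *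
  generalize densityMeasure (fun p : ℝ × E => n p.2 * d p.2 p.1) = ν at *
  have : IsProbabilityMeasure (μ.map Prod.snd) := by rwa [hμ]
  have := Measure.isProbabilityMeasure_of_map (μ := μ) (Prod.snd : ℝ × E → E)
  have : IsProbabilityMeasure (ν.map Prod.snd) := by rwa [hν]
  have := Measure.isProbabilityMeasure_of_map (μ := ν) (Prod.snd : ℝ × E → E)
  let π : (ℝ × E) × (ℝ × E) → E × E := Prod.map Prod.snd Prod.snd
  have hπm : Measurable π := measurable_snd.prodMap measurable_snd
  have hπ : (μ.prod ν).map π = (densityMeasure m).prod (densityMeasure n) := by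
    rw [← hμ, ← hν, Measure.map_prod_map _ _ measurable_snd measurable_snd]
  rw [← hπ] at hI hE0 hG
  have hIM : Integrable (M ∘ π) (μ.prod ν) := hI.comp_measurable hπm
  have hIS : Integrable (fun p : (ℝ × E) × (ℝ × E) => √lam * √(1 - lam) *
      (normalScore (c p.1.2) p.1.1 * normalScore (d p.2.2) p.2.1)) (μ.prod ν) :=
    (hIc.mul_prod hId).const_mul _
  refine ⟨fun p => M (π p) + √lam * √(1 - lam) *
      (normalScore (c p.1.2) p.1.1 * normalScore (d p.2.2) p.2.1), ρ ∘ π, ?_, hρ.comp hπm,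
    fun p => hρ1 _, hIM.add hIS, ?_, hK, fun h => ?_⟩
  · exact (hM.comp hπm).add (((hSc.comp measurable_fst).mul (hSd.comp measurable_snd)).const_mul _)
  · refine (integral_add hIM hIS).trans ?_
    rw [integral_map hπm.aemeasurable hM.aestronglyMeasurable] at hE0
    rw [integral_const_mul, integral_prod_mul (μ := μ) (ν := ν)
      (fun p => normalScore (c p.2) p.1) (fun p => normalScore (d p.2) p.1), hEc]
    simpa using hE0
  · rw [← Measure.map_map hℓ measurable_snd, ← Measure.map_map hℓ measurable_snd, hμ, hν]
    exact hG ((ae_map_iff hπm.aemeasurable (measurableSet_eq_fun hρ measurable_const)).2 h)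

end AddCoordinate

/-- Coordinates are added at the last position, so that the factor `ρ` of the kernel always comes
from the coordinate `0`. -/
theorem hasTransportKernel_pi {lam : ℝ} (h0 : 0 < lam) (h1 : lam < 1) (n : ℕ)
    {f g : (Fin (n + 1) → ℝ) → ℝ} (hf : IsPositiveDensity f) (hg : IsPositiveDensity g) :
    HasTransportKernel lam (fun x => x 0) f g := by
  induction n with
  | zero =>
    let e : ℝ ≃ᵐ (Fin 1 → ℝ) := (MeasurableEquiv.funUnique (Fin 1) ℝ).symm
    have he : MeasurePreserving e := (volume_preserving_funUnique (Fin 1) ℝ).symm _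
    exact HasTransportKernel.of_comp hf hg e he (fun a b x y => rfl) measurable_id
      (hasTransportKernel_real h0 h1 (hf.comp_measurableEquiv e he) (hg.comp_measurableEquiv e he))
  | succ n ih =>
    let e : ℝ × (Fin (n + 1) → ℝ) ≃ᵐ (Fin (n + 2) → ℝ) :=
      (MeasurableEquiv.piFinSuccAbove (fun _ => ℝ) (Fin.last (n + 1))).symm
    have he : MeasurePreserving e :=
      (volume_preserving_piFinSuccAbove (fun _ => ℝ) (Fin.last (n + 1))).symm _
    have hlin (a b : ℝ) (x y : ℝ × (Fin (n + 1) → ℝ)) :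
        e (a • x + b • y) = a • e x + b • e y := by
      apply e.symm.injective
      rw [e.symm_apply_apply]
      have hx := e.symm_apply_apply x
      have hy := e.symm_apply_apply y
      conv_lhs => rw [← hx, ← hy]
      rfl
    have hfst : ((fun x : Fin (n + 1) → ℝ => x 0) ∘ Prod.snd) ∘ e.symm =
        fun x : Fin (n + 2) → ℝ => x 0 := by
      ext x
      rfl
    rw [← hfst]
    exact HasTransportKernel.of_comp hf hg e he hlin (by fun_prop)
      (HasTransportKernel.prod h0 h1 (by fun_prop) (fun f g hf hg => ih hf hg)
        (hf.comp_measurableEquiv e he) (hg.comp_measurableEquiv e he))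

/-- Any unit vector `w` can be the first vector of an orthonormal basis, in whose coordinates the
linear form `inner ℝ w` is the coordinate `0`. -/
theorem hasTransportKernel_euclideanSpace {lam : ℝ} (h0 : 0 < lam) (h1 : lam < 1) (n : ℕ)
    {f g : EuclideanSpace ℝ (Fin (n + 1)) → ℝ} (hf : IsPositiveDensity f)
    (hg : IsPositiveDensity g) {w : EuclideanSpace ℝ (Fin (n + 1))} (hw : ‖w‖ = 1) :
    HasTransportKernel lam (fun x => inner ℝ w x) f g := by
  obtain ⟨b, hb⟩ := Orthonormal.exists_orthonormalBasis_extension_of_card_eq (𝕜 := ℝ)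
    (E := EuclideanSpace ℝ (Fin (n + 1))) (ι := Fin (n + 1)) (by simp)
    (v := fun _ => w) (s := {0}) (by simp [hw])
  have hb0 : b 0 = w := hb 0 rfl
  let e : (Fin (n + 1) → ℝ) ≃ᵐ EuclideanSpace ℝ (Fin (n + 1)) :=
    (MeasurableEquiv.toLp 2 (Fin (n + 1) → ℝ)).trans b.repr.symm.toMeasurableEquiv
  have he : MeasurePreserving e :=
    (b.measurePreserving_repr_symm).comp (PiLp.volume_preserving_toLp (Fin (n + 1)))
  have hlin (c d : ℝ) (x y : Fin (n + 1) → ℝ) : e (c • x + d • y) = c • e x + d • e y := by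
    simp [e]
  have hℓ : (fun x : Fin (n + 1) → ℝ => x 0) ∘ e.symm = fun x => inner ℝ w x := by
    ext x
    rw [← hb0, ← b.repr_apply_apply]
    rfl
  rw [← hℓ]
  exact HasTransportKernel.of_comp hf hg e he hlin (by fun_prop)
    (hasTransportKernel_pi h0 h1 n (hf.comp_measurableEquiv e he) (hg.comp_measurableEquiv e he))

/-- In dimension zero the volume is a Dirac mass and the only positive density is `1`. -/
theorem hasTransportKernel_euclideanSpace_zero (lam : ℝ)
    {f g : EuclideanSpace ℝ (Fin 0) → ℝ} (hf : IsPositiveDensity f) (hg : IsPositiveDensity g) :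
    HasTransportKernel lam (fun _ => 0) f g := by
  have := hf.isProbabilityMeasure
  have := hg.isProbabilityMeasure
  have hone {h : EuclideanSpace ℝ (Fin 0) → ℝ} (hh : IsPositiveDensity h)
      (x : EuclideanSpace ℝ (Fin 0)) : h x = 1 := by
    have := hh.lintegral_eq_one
    rw [volume_euclideanSpace_eq_dirac, lintegral_dirac, ENNReal.ofReal_eq_one] at this
    rwa [Subsingleton.elim x 0]
  refine ⟨fun _ => 0, fun _ => 1, measurable_const, measurable_const, fun _ => le_rfl,
    integrable_zero _ _ _, by simp, fun F hF => ?_, fun _ => ⟨0, 0, 0, by simp, by simp⟩⟩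
  simp only [hone hf, hone hg, volume_euclideanSpace_eq_dirac, lintegral_dirac]
  simp

/-! ### Entropy as an expectation of the logarithm of the density -/

section LogDensity

variable {E : Type*} [MeasureSpace E]

/-- Consequence of `log t ≤ t - 1`: an exponential with expectation at most one has an exponent with
nonpositive expectation. Integrability of the summands `L` and `R` comes out of one-sided bounds. -/
theorem integrable_of_lintegral_exp_le_one {α : Type*} [MeasurableSpace α] {π : Measure α}
    [IsProbabilityMeasure π] {L A R B : α → ℝ} (hL : Measurable L) (hR : Measurable R)
    (hA : Integrable A π) (hB : Integrable B π) (hR0 : ∀ x, 0 ≤ R x) (hBL : ∀ᵐ x ∂π, B x ≤ L x)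
    (h : ∫⁻ x, ENNReal.ofReal (Real.exp (L x + A x + R x)) ∂π ≤ 1) :
    Integrable L π ∧ Integrable R π ∧ ∫ x, L x ∂π + ∫ x, A x ∂π + ∫ x, R x ∂π ≤ 0 := by
  set W : α → ℝ := fun x => Real.exp (L x + A x + R x) with hW
  have hWm : AEStronglyMeasurable W π :=
    Real.continuous_exp.comp_aestronglyMeasurable
      ((hL.aestronglyMeasurable.add hA.aestronglyMeasurable).add hR.aestronglyMeasurable)
  have hW0 (x : α) : 0 ≤ W x := (Real.exp_pos _).le
  have hWi : Integrable W π :=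
    ⟨hWm, (hasFiniteIntegral_iff_ofReal (ae_of_all _ hW0)).2 (h.trans_lt ENNReal.one_lt_top)⟩
  have hW1 : ∫ x, W x ∂π ≤ 1 := by
    rw [integral_eq_lintegral_of_nonneg_ae (ae_of_all _ hW0) hWm]
    exact ENNReal.toReal_le_of_le_ofReal zero_le_one (by simpa using h)
  have hle (x : α) : L x + A x + R x ≤ W x - 1 := by
    have := Real.add_one_le_exp (L x + A x + R x)
    simp only [hW]
    linarith
  have hU : Integrable (fun x => W x - 1) π := hWi.sub (integrable_const _)
  have hLi : Integrable L π := by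
    refine integrable_of_le_of_le hL.aestronglyMeasurable hBL (ae_of_all _ fun x => ?_) hB
      (hU.sub hA)
    have := hle x
    have := hR0 x
    simp only [Pi.sub_apply]
    linarith
  have hRi : Integrable R π := by
    refine integrable_of_le_of_le hR.aestronglyMeasurable (ae_of_all _ hR0)
      (ae_of_all _ fun x => ?_) (integrable_zero _ _ _) ((hU.sub hA).sub hLi)
    have := hle x
    simp only [Pi.sub_apply]
    linarith
  refine ⟨hLi, hRi, ?_⟩
  have h1 : ∫ x, (L x + A x + R x) ∂π ≤ ∫ x, (W x - 1) ∂π :=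
    integral_mono ((hLi.add hA).add hRi) hU hle
  rw [integral_sub hWi (integrable_const _)] at h1
  have h2 : ∫ x, (L x + A x + R x) ∂π = ∫ x, L x ∂π + ∫ x, A x ∂π + ∫ x, R x ∂π := by
    rw [← integral_add hLi hA]
    exact integral_add (hLi.add hA) hRi
  simp only [integral_const, probReal_univ, one_smul] at h1
  linarith

theorem ae_withDensity_ne_zero {q : E → ℝ≥0∞} (hq : Measurable q) :
    ∀ᵐ z ∂(volume : Measure E).withDensity q, q z ≠ 0 := by
  rw [ae_withDensity_iff hq]
  exact ae_of_all _ fun z h => h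

/-- Under a finite second moment, the logarithm of the density has an integrable minorant: compare
the density with `exp (-‖z‖ ^ 2)`. -/
theorem exists_integrable_le_log_density {n : ℕ} {q : EuclideanSpace ℝ (Fin n) → ℝ≥0∞}
    (hq : Measurable q) [IsProbabilityMeasure (volume.withDensity q)]
    (h2 : Integrable (fun z => ‖z‖ ^ 2) (volume.withDensity q)) :
    ∃ B : EuclideanSpace ℝ (Fin n) → ℝ, Integrable B (volume.withDensity q) ∧
      ∀ᵐ z ∂volume.withDensity q, B z ≤ Real.log (q z).toReal := by
  have hgauss : Integrable fun z : EuclideanSpace ℝ (Fin n) => Real.exp (-‖z‖ ^ 2) := by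
    have := (GaussianFourier.integrable_cexp_neg_mul_sq_norm_add
      (V := EuclideanSpace ℝ (Fin n)) (b := 1) (by simp) 0 0).norm
    refine this.congr (ae_of_all _ fun z => ?_)
    simp only [Complex.norm_exp]
    congr 1
    simp [← Complex.ofReal_pow]
  have hqfin : ∀ᵐ z, q z < ∞ := by
    refine ae_lt_top hq ?_
    rw [← setLIntegral_univ, ← withDensity_apply _ MeasurableSet.univ]
    exact measure_ne_top _ _
  have hV : Integrable (fun z => Real.exp (-‖z‖ ^ 2) / (q z).toReal) (volume.withDensity q) := by
    rw [integrable_withDensity_iff_integrable_smul' hq hqfin]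
    refine hgauss.mono' (by fun_prop) (ae_of_all _ fun z => ?_)
    rw [smul_eq_mul, Real.norm_of_nonneg (by positivity)]
    rw [mul_div_left_comm]
    exact mul_le_of_le_one_right (Real.exp_pos _).le (div_self_le_one _)
  have hqfin' : ∀ᵐ z ∂volume.withDensity q, q z < ∞ :=
    (withDensity_absolutelyContinuous volume q).ae_le hqfin
  refine ⟨fun z => 1 - Real.exp (-‖z‖ ^ 2) / (q z).toReal - ‖z‖ ^ 2, ?_, ?_⟩
  · have h1 : Integrable (fun z => 1 - Real.exp (-‖z‖ ^ 2) / (q z).toReal)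
        (volume.withDensity q) := (integrable_const (1 : ℝ)).sub hV
    exact h1.sub h2
  · filter_upwards [ae_withDensity_ne_zero hq, hqfin'] with z hz hz'
    have hpos : 0 < (q z).toReal := ENNReal.toReal_pos hz hz'.ne
    have := Real.log_le_sub_one_of_pos (div_pos (Real.exp_pos (-‖z‖ ^ 2)) hpos)
    rw [Real.log_div (Real.exp_pos _).ne' hpos.ne', Real.log_exp] at this
    linarith

/-- The entropy inequality for product measures with a transport kernel, with the case of equality.
It is the transport inequality applied to the density `q` of `√lam X + √(1 - lam) Y`. -/
theorem HasTransportKernel.integral_log_le [AddCommGroup E] [Module ℝ E] [MeasurableAdd₂ E]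
    [MeasurableConstSMul ℝ E] {lam : ℝ} {ℓ : E → ℝ} {f g : E → ℝ}
    (h : HasTransportKernel lam ℓ f g) (hf : IsPositiveDensity f) (hg : IsPositiveDensity g)
    (hlf : Integrable (fun x => Real.log (f x)) (densityMeasure f))
    (hlg : Integrable (fun x => Real.log (g x)) (densityMeasure g))
    {q : E → ℝ≥0∞} (hq : Measurable q)
    (hZ : ((densityMeasure f).prod (densityMeasure g)).map
      (fun p => √lam • p.1 + √(1 - lam) • p.2) = volume.withDensity q)
    {B : E → ℝ} (hB : Integrable B (volume.withDensity q))
    (hBq : ∀ᵐ z ∂volume.withDensity q, B z ≤ Real.log (q z).toReal) :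
    Integrable (fun z => Real.log (q z).toReal) (volume.withDensity q) ∧
    ∫ z, Real.log (q z).toReal ∂volume.withDensity q ≤
      lam * ∫ x, Real.log (f x) ∂densityMeasure f +
        (1 - lam) * ∫ x, Real.log (g x) ∂densityMeasure g ∧
    (∫ z, Real.log (q z).toReal ∂volume.withDensity q =
      lam * ∫ x, Real.log (f x) ∂densityMeasure f +
        (1 - lam) * ∫ x, Real.log (g x) ∂densityMeasure g →
      ∃ m₁ m₂ v, (densityMeasure f).map ℓ = gaussianReal m₁ v ∧
        (densityMeasure g).map ℓ = gaussianReal m₂ v) := by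
  have := hf.isProbabilityMeasure
  have := hg.isProbabilityMeasure
  obtain ⟨M, ρ, hM, hρ, hρ1, hI, hE, hF, hG⟩ := h
  have hfm := hf.measurable
  have hgm := hg.measurable
  set π := (densityMeasure f).prod (densityMeasure g) with hπ
  let Z : E × E → E := fun p => √lam • p.1 + √(1 - lam) • p.2
  have hZm : Measurable Z := by fun_prop
  have hq1 : ∫⁻ z, q z = 1 := by
    rw [← setLIntegral_univ, ← withDensity_apply _ MeasurableSet.univ, ← hZ,
      Measure.map_apply hZm MeasurableSet.univ, preimage_univ, measure_univ]
  have hqfin : ∀ᵐ z, q z < ∞ := ae_lt_top hq (by simp [hq1])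
  let A : E × E → ℝ := fun p => M p - (lam * Real.log (f p.1) + (1 - lam) * Real.log (g p.2))
  have hl1 : Integrable (fun p : E × E => Real.log (f p.1)) π := hlf.comp_fst _
  have hl2 : Integrable (fun p : E × E => Real.log (g p.2)) π := hlg.comp_snd _
  have hA : Integrable A π := hI.sub ((hl1.const_mul _).add (hl2.const_mul _))
  have hEA : ∫ p, A p ∂π = -(lam * ∫ x, Real.log (f x) ∂densityMeasure f +
      (1 - lam) * ∫ x, Real.log (g x) ∂densityMeasure g) := by
    have h1 : ∫ p : E × E, Real.log (f p.1) ∂π = ∫ x, Real.log (f x) ∂densityMeasure f := by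
      rw [hπ, integral_fun_fst (fun x => Real.log (f x))]
      simp
    have h2 : ∫ p : E × E, Real.log (g p.2) ∂π = ∫ x, Real.log (g x) ∂densityMeasure g := by
      rw [hπ, integral_fun_snd (fun x => Real.log (g x))]
      simp
    rw [← h1, ← h2, ← integral_const_mul, ← integral_const_mul,
      ← integral_add (hl1.const_mul _) (hl2.const_mul _)]
    refine (integral_sub hI ((hl1.const_mul _).add (hl2.const_mul _))).trans ?_
    rw [hE, zero_sub]
    rfl
  let L : E × E → ℝ := fun p => Real.log (q (Z p)).toReal
  have hLm : Measurable L := (hq.comp hZm).ennreal_toReal.log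
  have hB' : Integrable (B ∘ Z) π := by
    rw [← hZ] at hB
    exact hB.comp_measurable hZm
  have hae {p : E → Prop} (hp : ∀ᵐ z ∂volume.withDensity q, p z) : ∀ᵐ x ∂π, p (Z x) := by
    rw [← hZ] at hp
    exact ae_of_ae_map hZm.aemeasurable hp
  have hexp : ∫⁻ p, ENNReal.ofReal (Real.exp (L p + A p + Real.log (ρ p))) ∂π ≤ 1 := by
    have h1 : ∫⁻ p, ENNReal.ofReal (Real.exp (L p + A p + Real.log (ρ p))) ∂π ≤
        ∫⁻ p, q (Z p) * ENNReal.ofReal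
          (Real.exp (M p) * ρ p * (f p.1 ^ (-lam) * g p.2 ^ (-(1 - lam)))) ∂π := by
      refine lintegral_mono_ae ?_
      filter_upwards [hae (ae_withDensity_ne_zero hq),
        hae ((withDensity_absolutelyContinuous volume q).ae_le hqfin)] with p hp hp'
      have hpos : 0 < (q (Z p)).toReal := ENNReal.toReal_pos hp hp'.ne
      have hf0 := hf.pos p.1
      have hg0 := hg.pos p.2
      have hρ0 := zero_lt_one.trans_le (hρ1 p)
      rw [← ENNReal.ofReal_toReal hp'.ne, ← ENNReal.ofReal_mul hpos.le]
      refine le_of_eq (congrArg ENNReal.ofReal ?_)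
      have : L p + A p + Real.log (ρ p) = Real.log (q (Z p)).toReal + M p + Real.log (ρ p) +
          Real.log (f p.1) * (-lam) + Real.log (g p.2) * (-(1 - lam)) := by
        simp only [L, A]
        ring
      rw [this, Real.exp_add, Real.exp_add, Real.exp_add, Real.exp_add, Real.exp_log hpos,
        Real.exp_log hρ0, Real.rpow_def_of_pos hf0, Real.rpow_def_of_pos hg0]
      ring
    refine h1.trans (le_trans (le_of_eq ?_) ((hF q hq).trans_eq hq1))
    have hK : Measurable fun p : E × E => q (Z p) * ENNReal.ofReal
        (Real.exp (M p) * ρ p * (f p.1 ^ (-lam) * g p.2 ^ (-(1 - lam)))) := by fun_prop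
    rw [hπ, lintegral_prod _ hK.aemeasurable, hf.lintegral_densityMeasure]
    refine lintegral_congr fun x => ?_
    rw [hg.lintegral_densityMeasure, ← lintegral_const_mul _ (by fun_prop)]
    refine lintegral_congr fun y => ?_
    have hf0 := hf.pos x
    have hg0 := hg.pos y
    have hρ0 := zero_lt_one.trans_le (hρ1 (x, y))
    have hf1 : f x * f x ^ (-lam) = f x ^ (1 - lam) := by
      rw [sub_eq_add_neg, Real.rpow_add hf0, Real.rpow_one]
    have hg1 : g y * g y ^ (-(1 - lam)) = g y ^ lam := by
      conv_rhs => rw [show lam = 1 + -(1 - lam) by ring, Real.rpow_add hg0, Real.rpow_one]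
    rw [mul_left_comm (ENNReal.ofReal (g y)), mul_left_comm (ENNReal.ofReal (f x)),
      ← ENNReal.ofReal_mul hg0.le, ← ENNReal.ofReal_mul hf0.le, ← hf1, ← hg1]
    congr 2
    ring
  obtain ⟨hLi, hRi, hsum⟩ := integrable_of_lintegral_exp_le_one hLm (hρ.log) hA hB'
    (fun p => Real.log_nonneg (hρ1 p)) (hae hBq) hexp
  have hlogm : Measurable fun z => Real.log (q z).toReal := hq.ennreal_toReal.log
  have hint : ∫ z, Real.log (q z).toReal ∂volume.withDensity q = ∫ p, L p ∂π := by
    rw [← hZ, integral_map hZm.aemeasurable hlogm.aestronglyMeasurable]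
  have hR0 : 0 ≤ ∫ p, Real.log (ρ p) ∂π := integral_nonneg fun p => Real.log_nonneg (hρ1 p)
  rw [hEA] at hsum
  refine ⟨?_, by rw [hint]; linarith, fun heq => hG ?_⟩
  · rw [← hZ]
    exact (integrable_map_measure hlogm.aestronglyMeasurable hZm.aemeasurable).2 hLi
  · rw [hint] at heq
    have hz : ∫ p, Real.log (ρ p) ∂π = 0 := le_antisymm (by linarith) hR0
    rw [integral_eq_zero_iff_of_nonneg (fun p => Real.log_nonneg (hρ1 p)) hRi] at hz
    filter_upwards [hz] with p hp
    exact Real.eq_one_of_pos_of_log_eq_zero (zero_lt_one.trans_le (hρ1 p)) hp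

end LogDensity

/-! ### Random vectors -/

section RandomVector

variable {Ω : Type*} [MeasurableSpace Ω] {P : Measure Ω} {n : ℕ}
  {X Y : Ω → EuclideanSpace ℝ (Fin n)}

theorem HasContinuousPositiveDensity.exists_isPositiveDensity [IsProbabilityMeasure P]
    (hX : HasContinuousPositiveDensity X P) :
    ∃ f, IsPositiveDensity f ∧ P.map X = densityMeasure f := by
  obtain ⟨f, hfc, hf0, hf⟩ := hX.exists_density
  refine ⟨f, ⟨hfc.measurable, hf0, ?_⟩, hf⟩
  have := Measure.isProbabilityMeasure_map (μ := P) hX.aemeasurable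
  rw [← setLIntegral_univ, ← withDensity_apply _ MeasurableSet.univ, ← hf, measure_univ]

theorem integrable_log_pdf_iff [IsFiniteMeasure P] [HasPDF X P volume] :
    Integrable (fun x => Real.log (pdf X P volume x).toReal) (P.map X) ↔
      Integrable fun x => (pdf X P volume x).toReal * Real.log (pdf X P volume x).toReal := by
  rw [map_eq_withDensity_pdf X P volume,
    integrable_withDensity_iff_integrable_smul' (measurable_pdf X P volume) pdf.ae_lt_top]
  rfl

theorem differentialEntropy_eq_integral_log [IsFiniteMeasure P] [HasPDF X P volume] :
    differentialEntropy X P = -∫ x, Real.log (pdf X P volume x).toReal ∂P.map X := by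
  rw [differentialEntropy, map_eq_withDensity_pdf X P volume,
    integral_withDensity_eq_integral_toReal_smul (measurable_pdf X P volume) pdf.ae_lt_top]
  rfl

/-- The chosen version of the density does not matter for expectations of its logarithm. -/
theorem log_pdf_ae_eq [IsFiniteMeasure P] [HasPDF X P volume]
    {f : EuclideanSpace ℝ (Fin n) → ℝ} (hf : IsPositiveDensity f)
    (hX : P.map X = densityMeasure f) :
    (fun x => Real.log (pdf X P volume x).toReal) =ᵐ[densityMeasure f]
      fun x => Real.log (f x) := by
  have h := (pdf.eq_of_map_eq_withDensity' (fun x => ENNReal.ofReal (f x))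
    hf.measurable.ennreal_ofReal.aemeasurable).1 hX
  filter_upwards [densityMeasure_absolutelyContinuous.ae_le h] with x hx
  rw [hx, ENNReal.toReal_ofReal (hf.pos x).le]

/-- The entropy depends on the law only up to translation. -/
theorem differentialEntropy_eq_of_map_eq_translate [IsProbabilityMeasure P] [HasPDF X P volume]
    [HasPDF Y P volume] {c : EuclideanSpace ℝ (Fin n)}
    (h : P.map Y = (P.map X).map (fun x => c + x)) :
    differentialEntropy Y P = differentialEntropy X P := by
  have hm := measurable_pdf X P volume
  have hY : P.map Y = volume.withDensity fun y => pdf X P volume (y - c) := by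
    rw [h]
    ext s hs
    rw [Measure.map_apply (by fun_prop) hs, map_eq_withDensity_pdf X P volume,
      withDensity_apply _ (measurable_const_add c hs), withDensity_apply _ hs]
    have := (measurePreserving_add_left (volume : Measure (EuclideanSpace ℝ (Fin n)))
      c).setLIntegral_comp_preimage hs
      (f := fun y => pdf X P volume (y - c)) (by fun_prop)
    simpa using this
  have hae := (pdf.eq_of_map_eq_withDensity' _ (by fun_prop)).1 hY
  rw [differentialEntropy, differentialEntropy]
  congr 1
  rw [← integral_sub_right_eq_self (fun x => (pdf X P volume x).toReal *
    Real.log (pdf X P volume x).toReal) c]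
  refine integral_congr_ae ?_
  filter_upwards [hae] with x hx
  rw [hx]

theorem map_add_smul_absolutelyContinuous {μ ν : Measure (EuclideanSpace ℝ (Fin n))}
    [SFinite μ] [SFinite ν] (hν : ν ≪ volume) (a : ℝ) {b : ℝ} (hb : b ≠ 0) :
    (μ.prod ν).map (fun p => a • p.1 + b • p.2) ≪ volume := by
  intro s hs
  obtain ⟨t, hst, ht, ht0⟩ := exists_measurable_superset_of_null hs
  have hZ : Measurable fun p : EuclideanSpace ℝ (Fin n) × EuclideanSpace ℝ (Fin n) =>
      a • p.1 + b • p.2 := by fun_prop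
  refine measure_mono_null hst ?_
  rw [Measure.map_apply hZ ht, Measure.measure_prod_null (hZ ht)]
  refine ae_of_all _ fun x => hν ?_
  have : Prod.mk x ⁻¹' ((fun p : EuclideanSpace ℝ (Fin n) × EuclideanSpace ℝ (Fin n) =>
      a • p.1 + b • p.2) ⁻¹' t) = (fun y => b • y) ⁻¹' ((fun y => a • x + y) ⁻¹' t) := rfl
  rw [this, Measure.addHaar_preimage_smul _ hb, measure_preimage_add, ht0, mul_zero]

/-! ### Covariances -/

theorem covarianceMatrix_apply_eq_covarianceBilin [IsFiniteMeasure P] (hX : MemLp X 2 P)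
    (i j : Fin n) : covarianceMatrix X P i j = covarianceBilin (P.map X)
      (EuclideanSpace.basisFun (Fin n) ℝ i) (EuclideanSpace.basisFun (Fin n) ℝ j) :=
  (covarianceBilin_apply_basisFun (X := fun i ω => X ω i) (fun i => hX.eval_piLp i) i j).symm

theorem memLp_id_map (hX : MemLp X 2 P) : MemLp id 2 (P.map X) :=
  (memLp_map_measure_iff aestronglyMeasurable_id hX.aestronglyMeasurable.aemeasurable).2 hX

theorem covarianceBilin_eq_iff [IsFiniteMeasure P] (hX : MemLp X 2 P) (hY : MemLp Y 2 P) :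
    covarianceBilin (P.map X) = covarianceBilin (P.map Y) ↔
      covarianceMatrix X P = covarianceMatrix Y P := by
  constructor
  · intro h
    ext i j
    rw [covarianceMatrix_apply_eq_covarianceBilin hX, covarianceMatrix_apply_eq_covarianceBilin hY,
      h]
  · intro h
    ext x y
    refine (covarianceBilin_apply_pi (X := fun i ω => X ω i) (fun i => hX.eval_piLp i) x y).trans
      (Eq.trans ?_
        (covarianceBilin_apply_pi (X := fun i ω => Y ω i) (fun i => hY.eval_piLp i) x y).symm)
    exact Finset.sum_congr rfl fun i _ => Finset.sum_congr rfl fun j _ =>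
      congrArg (x i * y j * ·) (congrFun (congrFun h i) j)

/-- Polarization: covariance forms are determined by their diagonal. -/
theorem covarianceBilin_ext_diag {μ ν : Measure (EuclideanSpace ℝ (Fin n))}
    (h : ∀ w, covarianceBilin μ w w = covarianceBilin ν w w) :
    covarianceBilin μ = covarianceBilin ν := by
  ext x y
  have h1 := h (x + y)
  simp only [map_add, add_apply, h x, h y, covarianceBilin_comm y x] at h1
  linarith

/-- A random vector with a density has a non-singular covariance matrix: no nonzero linear form of
it is almost surely constant, since hyperplanes are null sets. -/
theorem isUnit_det_covarianceMatrix [IsProbabilityMeasure P] (hX : MemLp X 2 P)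
    (hac : P.map X ≪ volume) : IsUnit (covarianceMatrix X P).det := by
  have hXm := hX.aestronglyMeasurable.aemeasurable
  have := Measure.isProbabilityMeasure_map hXm
  rw [isUnit_iff_ne_zero]
  intro hdet
  obtain ⟨v, hv0, hv⟩ := Matrix.exists_mulVec_eq_zero_iff.2 hdet
  set w : EuclideanSpace ℝ (Fin n) := WithLp.toLp 2 v with hw
  have hw0 : w ≠ 0 := fun h => hv0 (by simpa [hw] using h)
  have hvar : Var[fun u => inner ℝ w u; P.map X] = 0 := by
    rw [← covarianceBilin_self (memLp_id_map hX)]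
    refine (covarianceBilin_apply_pi (X := fun i ω => X ω i) (fun i => hX.eval_piLp i) w w).trans ?_
    refine Finset.sum_eq_zero fun i _ => ?_
    have h1 : ∑ j, covarianceMatrix X P i j * v j = 0 := congrFun hv i
    calc ∑ j, w i * w j * covarianceMatrix X P i j
        = w i * ∑ j, covarianceMatrix X P i j * v j := by
          rw [Finset.mul_sum]
          exact Finset.sum_congr rfl fun j _ => by rw [mul_assoc, mul_comm (w j)]
      _ = 0 := by rw [h1, mul_zero]
  have hL2 : MemLp (fun u => inner ℝ w u) 2 (P.map X) := (memLp_id_map hX).const_inner w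
  set k := ∫ u, inner ℝ w u ∂P.map X
  have hae : ∀ᵐ u ∂P.map X, inner ℝ w u = k := ae_eq_integral_of_variance_eq_zero hL2 hvar
  have hnull : volume {u : EuclideanSpace ℝ (Fin n) | inner ℝ w u = k} = 0 := by
    let A : AffineSubspace ℝ (EuclideanSpace ℝ (Fin n)) :=
      AffineSubspace.mk' ((k / inner ℝ w w) • w) (LinearMap.ker (innerₛₗ ℝ w))
    have hww : inner ℝ w w ≠ (0 : ℝ) := by simpa using hw0
    have hA (u) : u ∈ A ↔ inner ℝ w u = k := by
      simp only [A, AffineSubspace.mem_mk', LinearMap.mem_ker, vsub_eq_sub, innerₛₗ_apply_apply,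
        inner_sub_right, inner_smul_right]
      rw [div_mul_cancel₀ _ hww, sub_eq_zero]
    have htop : A ≠ ⊤ := by
      intro h
      have h1 := (hA 0).1 (h ▸ AffineSubspace.mem_top ℝ _ _)
      have h2 := (hA w).1 (h ▸ AffineSubspace.mem_top ℝ _ _)
      rw [inner_zero_right] at h1
      exact hww (h2.trans h1.symm)
    rw [← Measure.addHaar_affineSubspace volume A htop]
    congr 1
    ext u
    exact (hA u).symm
  have h0 : (P.map X) {u | inner ℝ w u = k} = 0 := hac hnull
  have hfalse : ∀ᵐ u ∂P.map X, False := by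
    filter_upwards [hae, compl_mem_ae_iff.2 h0] with u hu hu'
    exact hu' hu
  exact hfalse.exists.elim fun _ h => h

theorem hasGaussianLaw_of_map_inner (hXm : AEMeasurable X P) [IsProbabilityMeasure P]
    (h : ∀ w : EuclideanSpace ℝ (Fin n), ‖w‖ = 1 →
      ∃ m v, (P.map X).map (fun x => inner ℝ w x) = gaussianReal m v) : HasGaussianLaw X P := by
  have := Measure.isProbabilityMeasure_map hXm
  refine ⟨isGaussian_of_map_eq_gaussianReal fun L => ?_⟩
  set w := (InnerProductSpace.toDual ℝ (EuclideanSpace ℝ (Fin n))).symm L with hw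
  have hL : (L : EuclideanSpace ℝ (Fin n) → ℝ) = fun x => inner ℝ w x := by
    ext x
    rw [hw, InnerProductSpace.toDual_symm_apply]
  rw [hL]
  by_cases hw0 : w = 0
  · exact ⟨0, 0, by simp [hw0]⟩
  · obtain ⟨m, v, hmv⟩ := h (‖w‖⁻¹ • w) (by simp [norm_smul, hw0])
    have hcomp : (fun x => inner ℝ w x) = (fun t => ‖w‖ * t) ∘
        fun x : EuclideanSpace ℝ (Fin n) => inner ℝ (‖w‖⁻¹ • w) x := by
      ext x
      simp [real_inner_smul_left, hw0]
    rw [hcomp, ← Measure.map_map (by fun_prop) (by fun_prop), hmv, gaussianReal_map_const_mul]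
    exact ⟨_, _, rfl⟩

theorem covarianceBilin_eq_of_map_inner [IsProbabilityMeasure P] (hX : MemLp X 2 P)
    (hY : MemLp Y 2 P)
    (h : ∀ w : EuclideanSpace ℝ (Fin n), ‖w‖ = 1 →
      ∃ m₁ m₂ v, (P.map X).map (fun x => inner ℝ w x) = gaussianReal m₁ v ∧
        (P.map Y).map (fun x => inner ℝ w x) = gaussianReal m₂ v) :
    covarianceBilin (P.map X) = covarianceBilin (P.map Y) := by
  have := Measure.isProbabilityMeasure_map hX.aestronglyMeasurable.aemeasurable
  have := Measure.isProbabilityMeasure_map hY.aestronglyMeasurable.aemeasurable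
  refine covarianceBilin_ext_diag fun w => ?_
  by_cases hw0 : w = 0
  · simp [hw0]
  · obtain ⟨m₁, m₂, v, h1, h2⟩ := h (‖w‖⁻¹ • w) (by simp [norm_smul, hw0])
    have hvar {μ : Measure (EuclideanSpace ℝ (Fin n))} [IsProbabilityMeasure μ]
        (hμ : MemLp id 2 μ) {m : ℝ}
        (hm : μ.map (fun x => inner ℝ (‖w‖⁻¹ • w) x) = gaussianReal m v) :
        covarianceBilin μ w w = ‖w‖ ^ 2 * v := by
      have h3 : covarianceBilin μ (‖w‖⁻¹ • w) (‖w‖⁻¹ • w) = v := by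
        rw [covarianceBilin_self hμ, ← variance_id_gaussianReal (μ := m) (v := v), ← hm,
          variance_map aemeasurable_id (by fun_prop)]
        rfl
      have h4 : w = ‖w‖ • (‖w‖⁻¹ • w) := by simp [hw0]
      rw [← h3]
      conv_lhs => rw [h4]
      simp only [map_smul, smul_apply, smul_eq_mul]
      ring
    rw [hvar (memLp_id_map hX) h1, hvar (memLp_id_map hY) h2]

theorem covarianceBilin_add_smul [IsProbabilityMeasure P] (hXY : IndepFun X Y P)
    (hX : MemLp X 2 P) (hY : MemLp Y 2 P) (a b : ℝ) (w : EuclideanSpace ℝ (Fin n)) :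
    covarianceBilin (P.map fun ω => a • X ω + b • Y ω) w w =
      a ^ 2 * covarianceBilin (P.map X) w w + b ^ 2 * covarianceBilin (P.map Y) w w := by
  have hvar {W : Ω → EuclideanSpace ℝ (Fin n)} (hW : MemLp W 2 P) :
      covarianceBilin (P.map W) w w = Var[fun ω => inner ℝ w (W ω); P] := by
    have hWm := hW.aestronglyMeasurable.aemeasurable
    have := Measure.isProbabilityMeasure_map hWm
    rw [covarianceBilin_self (memLp_id_map hW), variance_map (by fun_prop) hWm]
    rfl
  have hZ : MemLp (fun ω => a • X ω + b • Y ω) 2 P := (hX.const_smul a).add (hY.const_smul b)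
  have hX' : MemLp (fun ω => a * inner ℝ w (X ω)) 2 P := (hX.const_inner w).const_mul a
  have hY' : MemLp (fun ω => b * inner ℝ w (Y ω)) 2 P := (hY.const_inner w).const_mul b
  have hind : IndepFun (fun ω => a * inner ℝ w (X ω)) (fun ω => b * inner ℝ w (Y ω)) P :=
    hXY.comp (φ := fun x => a * inner ℝ w x) (ψ := fun y => b * inner ℝ w y)
      (by fun_prop) (by fun_prop)
  rw [hvar hZ, hvar hX, hvar hY, ← variance_const_mul, ← variance_const_mul,
    ← hind.variance_fun_add hX' hY']
  simp only [inner_add_right, inner_smul_right]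

end RandomVector

/-! ### The entropy inequality for random vectors -/

section Main

variable {Ω : Type*} [MeasurableSpace Ω] {P : Measure Ω} [IsProbabilityMeasure P] {n : ℕ}
  {X Y : Ω → EuclideanSpace ℝ (Fin n)} {lam : ℝ}

theorem map_add_smul_eq_map_prod (hXY : IndepFun X Y P) (hX : AEMeasurable X P)
    (hY : AEMeasurable Y P) (a b : ℝ) :
    P.map (fun ω => a • X ω + b • Y ω) =
      ((P.map X).prod (P.map Y)).map (fun p => a • p.1 + b • p.2) := by
  rw [← (indepFun_iff_map_prod_eq_prod_map_map hX hY).1 hXY,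
    AEMeasurable.map_map_of_aemeasurable (by fun_prop) (hX.prodMk hY)]
  rfl

theorem hasPDF_add_smul (hXY : IndepFun X Y P) (hX : AEMeasurable X P) [HasPDF Y P volume] (a : ℝ)
    {b : ℝ} (hb : b ≠ 0) : HasPDF (fun ω => a • X ω + b • Y ω) P volume := by
  have hY : AEMeasurable Y P := HasPDF.aemeasurable Y P volume
  have := Measure.isProbabilityMeasure_map hX
  have := Measure.isProbabilityMeasure_map hY
  have hZ : AEMeasurable (fun ω => a • X ω + b • Y ω) P := (hX.const_smul a).add (hY.const_smul b)
  have := Measure.isProbabilityMeasure_map hZ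
  refine ⟨hZ, inferInstance, ?_⟩
  rw [map_add_smul_eq_map_prod hXY hX hY]
  exact map_add_smul_absolutelyContinuous HasPDF.absolutelyContinuous a hb

/-- The entropy inequality deduced from a transport kernel; in the case of equality the linear form
`ℓ` has Gaussian distributions with the same variance. -/
theorem entropy_inequality_of_hasTransportKernel (hlam1 : lam < 1) (hXY : IndepFun X Y P)
    {f g : EuclideanSpace ℝ (Fin n) → ℝ} (hf : IsPositiveDensity f) (hg : IsPositiveDensity g)
    (hXf : P.map X = densityMeasure f) (hYg : P.map Y = densityMeasure g)
    (hXh : HasFiniteDifferentialEntropy X P) (hYh : HasFiniteDifferentialEntropy Y P)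
    (hX2 : MemLp X 2 P) (hY2 : MemLp Y 2 P) {ℓ : EuclideanSpace ℝ (Fin n) → ℝ}
    (h : HasTransportKernel lam ℓ f g) :
    HasFiniteDifferentialEntropy (fun ω => √lam • X ω + √(1 - lam) • Y ω) P ∧
    lam * differentialEntropy X P + (1 - lam) * differentialEntropy Y P ≤
      differentialEntropy (fun ω => √lam • X ω + √(1 - lam) • Y ω) P ∧
    (differentialEntropy (fun ω => √lam • X ω + √(1 - lam) • Y ω) P =
        lam * differentialEntropy X P + (1 - lam) * differentialEntropy Y P →
      ∃ m₁ m₂ v, (P.map X).map ℓ = gaussianReal m₁ v ∧ (P.map Y).map ℓ = gaussianReal m₂ v) := by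
  have := hXh.hasPDF
  have := hYh.hasPDF
  have hXm : AEMeasurable X P := HasPDF.aemeasurable X P volume
  have hYm : AEMeasurable Y P := HasPDF.aemeasurable Y P volume
  set Z : Ω → EuclideanSpace ℝ (Fin n) := fun ω => √lam • X ω + √(1 - lam) • Y ω with hZdef
  have hZpdf : HasPDF Z P volume :=
    hasPDF_add_smul hXY hXm _ (Real.sqrt_pos.2 (sub_pos.2 hlam1)).ne'
  have hZm : AEMeasurable Z P := HasPDF.aemeasurable Z P volume
  have hZ2 : MemLp Z 2 P := (hX2.const_smul √lam).add (hY2.const_smul √(1 - lam))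
  have hZlaw := map_eq_withDensity_pdf Z P volume
  have := Measure.isProbabilityMeasure_map hZm
  have hprob : IsProbabilityMeasure (volume.withDensity (pdf Z P volume)) := hZlaw ▸ this
  have hZsq : Integrable (fun z => ‖z‖ ^ 2) (volume.withDensity (pdf Z P volume)) := by
    rw [← hZlaw]
    exact (memLp_id_map hZ2).integrable_norm_pow two_ne_zero
  obtain ⟨B, hB, hBq⟩ := exists_integrable_le_log_density (measurable_pdf Z P volume) hZsq
  have hlX := log_pdf_ae_eq hf hXf
  have hlY := log_pdf_ae_eq hg hYg
  have hlf : Integrable (fun x => Real.log (f x)) (densityMeasure f) := by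
    have := integrable_log_pdf_iff.2 hXh.integrable
    rw [hXf] at this
    exact this.congr hlX
  have hlg : Integrable (fun x => Real.log (g x)) (densityMeasure g) := by
    have := integrable_log_pdf_iff.2 hYh.integrable
    rw [hYg] at this
    exact this.congr hlY
  have hmap : ((densityMeasure f).prod (densityMeasure g)).map
      (fun p => √lam • p.1 + √(1 - lam) • p.2) = volume.withDensity (pdf Z P volume) := by
    rw [← hZlaw, ← hXf, ← hYg, map_add_smul_eq_map_prod hXY hXm hYm]
  obtain ⟨hint, hle, heq⟩ := h.integral_log_le hf hg hlf hlg (measurable_pdf Z P volume) hmap hB hBq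
  have hhX : differentialEntropy X P = -∫ x, Real.log (f x) ∂densityMeasure f := by
    rw [differentialEntropy_eq_integral_log, hXf, integral_congr_ae hlX]
  have hhY : differentialEntropy Y P = -∫ x, Real.log (g x) ∂densityMeasure g := by
    rw [differentialEntropy_eq_integral_log, hYg, integral_congr_ae hlY]
  have hhZ : differentialEntropy Z P = -∫ z, Real.log (pdf Z P volume z).toReal
      ∂volume.withDensity (pdf Z P volume) := by
    rw [differentialEntropy_eq_integral_log, hZlaw]
  rw [hhX, hhY, hhZ, hXf, hYg]
  refine ⟨⟨hZpdf, integrable_log_pdf_iff.1 ?_⟩, by linarith, fun h => heq (by linarith)⟩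
  rwa [hZlaw]

/-- Gaussian vectors with the same covariance matrix, and their normalized sum, have the same law up
to translation, hence the same entropy. -/
theorem entropy_eq_of_isGaussianVector (hlam0 : 0 < lam) (hlam1 : lam < 1) (hXY : IndepFun X Y P)
    [HasPDF X P volume] [HasPDF Y P volume] (hX : HasGaussianLaw X P) (hY : HasGaussianLaw Y P)
    (hcov : covarianceMatrix X P = covarianceMatrix Y P) :
    differentialEntropy (fun ω => √lam • X ω + √(1 - lam) • Y ω) P =
      lam * differentialEntropy X P + (1 - lam) * differentialEntropy Y P := by
  have hX2 : MemLp X 2 P := hX.memLp_two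
  have hY2 : MemLp Y 2 P := hY.memLp_two
  have hXm : AEMeasurable X P := HasPDF.aemeasurable X P volume
  have hbil := (covarianceBilin_eq_iff hX2 hY2).2 hcov
  have hpdf := hasPDF_add_smul hXY hXm √lam (Real.sqrt_pos.2 (sub_pos.2 hlam1)).ne'
  have htranslate {W : Ω → EuclideanSpace ℝ (Fin n)} (hW : HasGaussianLaw W P)
      (hWpdf : HasPDF W P volume)
      (hWb : covarianceBilin (P.map W) = covarianceBilin (P.map X)) :
      differentialEntropy W P = differentialEntropy X P := by
    have := hX.isGaussian_map
    have := hW.isGaussian_map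
    refine differentialEntropy_eq_of_map_eq_translate
      (c := ∫ u, u ∂P.map W - ∫ u, u ∂P.map X) (IsGaussian.ext ?_ ?_)
    · have hid : Integrable (fun u => u) (P.map X) := IsGaussian.integrable_id
      have h1 : ∫ u, u ∂(P.map X).map
          (fun x => ∫ u, u ∂P.map W - ∫ u, u ∂P.map X + x) = ∫ u, u ∂P.map W := by
        rw [integral_map (by fun_prop) (by fun_prop), integral_add (integrable_const _) hid]
        simp
      exact h1.symm
    · rw [covarianceBilin_map_const_add, hWb]
  have hZ : HasGaussianLaw (fun ω => √lam • X ω + √(1 - lam) • Y ω) P :=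
    (IndepFun.hasGaussianLaw (hX.fun_smul _) (hY.fun_smul _) (hXY.comp
      (φ := fun x => √lam • x) (ψ := fun y => √(1 - lam) • y) (by fun_prop)
      (by fun_prop))).fun_add
  have hZb : covarianceBilin (P.map fun ω => √lam • X ω + √(1 - lam) • Y ω) =
      covarianceBilin (P.map X) := by
    refine covarianceBilin_ext_diag fun w => ?_
    rw [covarianceBilin_add_smul hXY hX2 hY2, ← hbil, Real.sq_sqrt hlam0.le,
      Real.sq_sqrt (sub_pos.2 hlam1).le]
    ring
  rw [htranslate hZ hpdf hZb, htranslate hY inferInstance hbil.symm]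
  ring

end Main

theorem mainTheorem1 {Ω : Type*} [MeasurableSpace Ω] (P : Measure Ω) [IsProbabilityMeasure P]
    (n : ℕ) (X Y : Ω → EuclideanSpace ℝ (Fin n))
    (hXY : IndepFun X Y P)
    (hXd : HasContinuousPositiveDensity X P) (hYd : HasContinuousPositiveDensity Y P)
    (hXh : HasFiniteDifferentialEntropy X P) (hYh : HasFiniteDifferentialEntropy Y P)
    (hX2 : MemLp X 2 P) (hY2 : MemLp Y 2 P)
    (lam : ℝ) (hlam0 : 0 < lam) (hlam1 : lam < 1) :
    HasFiniteDifferentialEntropy (fun ω => √lam • X ω + √(1 - lam) • Y ω) P ∧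
    differentialEntropy (fun ω => √lam • X ω + √(1 - lam) • Y ω) P
      ≥ lam * differentialEntropy X P + (1 - lam) * differentialEntropy Y P ∧
    (differentialEntropy (fun ω => √lam • X ω + √(1 - lam) • Y ω) P
        = lam * differentialEntropy X P + (1 - lam) * differentialEntropy Y P ↔
      IsGaussianVector X P ∧ IsGaussianVector Y P ∧
        covarianceMatrix X P = covarianceMatrix Y P) := by
  obtain ⟨f, hf, hXf⟩ := hXd.exists_isPositiveDensity
  obtain ⟨g, hg, hYg⟩ := hYd.exists_isPositiveDensity
  have := hXh.hasPDF
  have := hYh.hasPDF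
  have key {ℓ : EuclideanSpace ℝ (Fin n) → ℝ} (h : HasTransportKernel lam ℓ f g) :=
    entropy_inequality_of_hasTransportKernel hlam1 hXY hf hg hXf hYg hXh hYh hX2 hY2 h
  have hker (w : EuclideanSpace ℝ (Fin n)) (hw : ‖w‖ = 1) :
      HasTransportKernel lam (fun x => inner ℝ w x) f g := by
    cases n with
    | zero => simp [Subsingleton.elim w 0] at hw
    | succ n => exact hasTransportKernel_euclideanSpace hlam0 hlam1 n hf hg hw
  have hex : ∃ ℓ : EuclideanSpace ℝ (Fin n) → ℝ, HasTransportKernel lam ℓ f g := by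
    cases n with
    | zero => exact ⟨_, hasTransportKernel_euclideanSpace_zero lam hf hg⟩
    | succ n => exact ⟨_, hker (EuclideanSpace.single 0 1) (by simp)⟩
  obtain ⟨ℓ, hℓ⟩ := hex
  refine ⟨(key hℓ).1, (key hℓ).2.1, fun heq => ?_, fun ⟨hXG, hYG, hcov⟩ =>
    entropy_eq_of_isGaussianVector hlam0 hlam1 hXY hXG.hasGaussianLaw hYG.hasGaussianLaw hcov⟩
  have hgauss (w : EuclideanSpace ℝ (Fin n)) (hw : ‖w‖ = 1) := (key (hker w hw)).2.2 heq
  refine ⟨⟨hasGaussianLaw_of_map_inner hXd.aemeasurable fun w hw => ?_,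
      isUnit_det_covarianceMatrix hX2 HasPDF.absolutelyContinuous⟩,
    ⟨hasGaussianLaw_of_map_inner hYd.aemeasurable fun w hw => ?_,
      isUnit_det_covarianceMatrix hY2 HasPDF.absolutelyContinuous⟩,
    (covarianceBilin_eq_iff hX2 hY2).1 (covarianceBilin_eq_of_map_inner hX2 hY2 hgauss)⟩
  · obtain ⟨m₁, -, v, h, -⟩ := hgauss w hw
    exact ⟨m₁, v, h⟩
  · obtain ⟨-, m₂, v, -, h⟩ := hgauss w hw
    exact ⟨m₂, v, h⟩
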